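/- Let $\mathbf{F}$ be an algebraically closed field, of arbitrary characteristic, that is complete with respect to a non-Archimedean absolute value $|\cdot|$. For an integer $m\ge 0$ let $\mathcal{E}_m$ be the ring of entire functions on $\mathbf{F}^m$, i.e. of formal power series $\sum_\gamma a_\gamma z^\gamma$ in $m$ variables with coefficients in $\mathbf{F}$ such that $\lim_{|\gamma|\to\infty}|a_\gamma|\,r_1^{\gamma_1}\cdots r_m^{\gamma_m}=0$ for all $m$-tuples $(r_1,\dots,r_m)$ of non-negative real numbers. Theorem (existence of the square-free part). Let $f\in\mathcal{E}_m$ with $f\ne 0$. Then there exists $S(f)\in\mathcal{E}_m$ such that $S(f)$ is square-free (if $g\in\mathcal{E}_m$ and $g^2$ divides $S(f)$ in $\mathcal{E}_m$, then $g$ is a unit of $\mathcal{E}_m$) and such that an irreducible element $P$ of $\mathcal{E}_m$ divides $S(f)$ in $\mathcal{E}_m$ if and only if $P$ divides $f$ in $\mathcal{E}_m$. -/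

import Mathlib

/-- The ring of entire functions on affine `m`-space over a non-Archimedean normed field `F`:
formal power series `∑ a_γ z^γ` in `m` variables over `F` with infinite radius of convergence,
that is, `‖a_γ‖ * r^γ → 0` (along the cofinite filter on multi-indices, equivalently as
`|γ| → ∞`) for every `m`-tuple `r` of non-negative real numbers. -/
def entireRing (F : Type*) [NormedField F] [IsUltrametricDist F] (m : ℕ) :
    Subring (MvPowerSeries (Fin m) F) where
  carrier := {f | ∀ r : Fin m → ℝ, (∀ i, 0 ≤ r i) → MvPowerSeries.IsRestricted r f}
  zero_mem' := fun r _ => MvPowerSeries.isRestricted_zero r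
  one_mem' := fun r _ => MvPowerSeries.isRestricted_one r
  add_mem' := fun hf hg r hr => MvPowerSeries.isRestricted.add r (hf r hr) (hg r hr)
  neg_mem' := fun hf r hr => MvPowerSeries.isRestricted.neg r (hf r hr)
  mul_mem' := fun hf hg r hr => MvPowerSeries.isRestricted.mul r (hf r hr) (hg r hr)

/-!
The square-free part is constructed on closed polydiscs and glued.

On a closed polydisc, which may be scaled to the unit polydisc, the ring of analytic functions is
the Tate algebra `tateAlgebra (Fin m) F` of power series with coefficients tending to zero. It is
factorial, by induction on `m`. Any nonzero element becomes distinguished in one variable after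
Nagata's shear `X i ↦ X i + X 0 ^ (B ^ i)` (`exists_ringEquiv_isDistinguished`), and by Weierstrass
division (`IsDistinguished.exists_eq_mul_add`) a distinguished element divides a monic polynomial
over the Tate algebra in one variable less. The monic prime factors of that polynomial remain prime
for convergent series (`prime_ofPolynomial`), so the given element is a product of primes.

If the absolute value is nontrivial, choose `c` with `1 < ‖c‖`; an entire function is a compatible
sequence of functions on the polydiscs of radii `‖c‖ ^ n`. Divisors given on these polydiscs, and
compatible up to units, are glued by an entire function (`isApproximation_ofEntire`): the transition
units may be normalised to constant term one, and a unit with constant term one tends geometrically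
to `1` on shrinking polydiscs, so the multiplicative Cousin problem is solved by a convergent
infinite product (`exists_units_eq_mul_contract`).

The remaining argument, `IsApproximation.exists_squarefree_part`, uses divisibility alone. The
square-free parts of `f` on larger and larger polydiscs, restricted to a fixed one, form an
ascending chain of divisors of `f`, hence stabilise up to units, and the stable values glue to `S`.
No derivative is taken, so the characteristic plays no role, and it is not needed that square-free
elements restrict to square-free elements on smaller polydiscs. If the absolute value is trivial,
the entire functions coincide with the Tate algebra and form a factorial ring themselves.
-/

/-! ### The Tate algebra with its Gauss norm -/

open Filter Topology

/-- The Tate algebra over a normed ring `A` in the variables `σ`: the power series whose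
coefficients tend to zero, that is, those converging on the closed unit polydisc. -/
def tateAlgebra (σ A : Type*) [NormedCommRing A] [IsUltrametricDist A] :
    Subring (MvPowerSeries σ A) :=
  MvPowerSeries.IsRestricted.subring 1

namespace tateAlgebra

section Norm

variable {σ A : Type*} [NormedCommRing A] [IsUltrametricDist A]

lemma mem_iff {f : MvPowerSeries σ A} :
    f ∈ tateAlgebra σ A ↔ Tendsto (fun γ => ‖MvPowerSeries.coeff γ f‖) cofinite (𝓝 0) := by
  change MvPowerSeries.IsRestricted 1 f ↔ _
  simp [MvPowerSeries.IsRestricted]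

/-- The coefficient of a monomial, as an additive map on the Tate algebra. -/
noncomputable def coeff (γ : σ →₀ ℕ) : tateAlgebra σ A →+ A :=
  (MvPowerSeries.coeff γ).toAddMonoidHom.comp (tateAlgebra σ A).subtype.toAddMonoidHom

lemma coeff_def (γ : σ →₀ ℕ) (f : tateAlgebra σ A) : coeff γ f = MvPowerSeries.coeff γ f.1 := rfl

lemma ext {f g : tateAlgebra σ A} (h : ∀ γ, coeff γ f = coeff γ g) : f = g :=
  Subtype.ext (MvPowerSeries.ext h)

lemma coeff_mul [DecidableEq σ] (γ : σ →₀ ℕ) (f g : tateAlgebra σ A) :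
    coeff γ (f * g) = ∑ p ∈ Finset.HasAntidiagonal.antidiagonal γ, coeff p.1 f * coeff p.2 g :=
  MvPowerSeries.coeff_mul γ f.1 g.1

lemma tendsto_norm_coeff (f : tateAlgebra σ A) :
    Tendsto (fun γ => ‖coeff γ f‖) cofinite (𝓝 0) := mem_iff.1 f.2

lemma finite_le_norm_coeff (f : tateAlgebra σ A) {ε : ℝ} (hε : 0 < ε) :
    {γ | ε ≤ ‖coeff γ f‖}.Finite := by
  have := (tendsto_norm_coeff f).eventually (gt_mem_nhds hε)
  simpa [Filter.eventually_cofinite] using this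

lemma bddAbove_norm_coeff (f : tateAlgebra σ A) :
    BddAbove (Set.range fun γ => ‖coeff γ f‖) :=
  (tendsto_norm_coeff f).bddAbove_range_of_cofinite

/-- The Gauss norm. -/
noncomputable instance : Norm (tateAlgebra σ A) := ⟨fun f => ⨆ γ, ‖coeff γ f‖⟩

lemma norm_def (f : tateAlgebra σ A) : ‖f‖ = ⨆ γ, ‖coeff γ f‖ := rfl

lemma norm_coeff_le (f : tateAlgebra σ A) (γ : σ →₀ ℕ) : ‖coeff γ f‖ ≤ ‖f‖ :=
  le_ciSup (bddAbove_norm_coeff f) γ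

lemma norm_le {f : tateAlgebra σ A} {C : ℝ} (h : ∀ γ, ‖coeff γ f‖ ≤ C) : ‖f‖ ≤ C :=
  ciSup_le h

lemma norm_nonneg' (f : tateAlgebra σ A) : 0 ≤ ‖f‖ :=
  (norm_nonneg _).trans (norm_coeff_le f 0)

/-- The Gauss norm is attained by some coefficient. -/
lemma exists_norm_coeff_eq (f : tateAlgebra σ A) : ∃ γ, ‖coeff γ f‖ = ‖f‖ := by
  rcases (norm_nonneg' f).eq_or_lt with h | h
  · exact ⟨0, le_antisymm (norm_coeff_le f 0) (h ▸ norm_nonneg _)⟩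
  · have hfin := finite_le_norm_coeff f (half_pos h)
    obtain ⟨γ₀, hγ₀⟩ := exists_lt_of_lt_ciSup (norm_def f ▸ half_lt_self h)
    obtain ⟨γ, hγ, hmax⟩ := hfin.exists_maximalFor (fun γ => ‖coeff γ f‖) _ ⟨γ₀, hγ₀.le⟩
    refine ⟨γ, le_antisymm (norm_coeff_le f γ) (norm_le fun δ => ?_)⟩
    by_contra! hδ
    exact hδ.not_ge (hmax (hγ.trans hδ.le) hδ.le)

lemma norm_lt {f : tateAlgebra σ A} {C : ℝ} (h : ∀ γ, ‖coeff γ f‖ < C) : ‖f‖ < C := by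
  obtain ⟨γ, hγ⟩ := exists_norm_coeff_eq f
  exact hγ ▸ h γ

lemma norm_add_le_max (f g : tateAlgebra σ A) : ‖f + g‖ ≤ max ‖f‖ ‖g‖ :=
  norm_le fun γ => by
    rw [map_add]
    exact (IsUltrametricDist.norm_add_le_max _ _).trans
      (max_le_max (norm_coeff_le f γ) (norm_coeff_le g γ))

lemma norm_mul_le' (f g : tateAlgebra σ A) : ‖f * g‖ ≤ ‖f‖ * ‖g‖ := by
  classical
  refine norm_le fun γ => ?_
  rw [coeff_mul]
  refine IsUltrametricDist.norm_sum_le_of_forall_le_of_nonneg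
    (mul_nonneg (norm_nonneg' f) (norm_nonneg' g)) fun p _ => (norm_mul_le _ _).trans ?_
  exact mul_le_mul (norm_coeff_le f _) (norm_coeff_le g _) (norm_nonneg _) (norm_nonneg' f)

noncomputable instance : NormedAddCommGroup (tateAlgebra σ A) :=
  AddGroupNorm.toNormedAddCommGroup
    { toFun := norm
      map_zero' := le_antisymm (norm_le fun γ => by simp) (norm_nonneg' _)
      add_le' := fun f g => (norm_add_le_max f g).trans
        (max_le_add_of_nonneg (norm_nonneg' f) (norm_nonneg' g))
      neg' := fun f => by simp only [norm_def, map_neg, norm_neg]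
      eq_zero_of_map_eq_zero' := fun f hf => ext fun γ => by
        rw [map_zero, ← norm_le_zero_iff]
        exact hf ▸ norm_coeff_le f γ }

noncomputable instance : NormedCommRing (tateAlgebra σ A) where
  __ := (inferInstance : CommRing (tateAlgebra σ A))
  __ := (inferInstance : NormedAddCommGroup (tateAlgebra σ A))
  norm_mul_le := norm_mul_le'

instance : IsUltrametricDist (tateAlgebra σ A) :=
  IsUltrametricDist.isUltrametricDist_of_forall_norm_add_le_max_norm norm_add_le_max

lemma coeff_one_zero : coeff 0 (1 : tateAlgebra σ A) = 1 := by
  classical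
  simp [coeff_def, MvPowerSeries.coeff_one]

lemma coeff_one_of_ne {γ : σ →₀ ℕ} (h : γ ≠ 0) : coeff γ (1 : tateAlgebra σ A) = 0 := by
  classical
  simp [coeff_def, MvPowerSeries.coeff_one, h]

instance [NormOneClass A] : NormOneClass (tateAlgebra σ A) where
  norm_one := le_antisymm
    (norm_le fun γ => by
      by_cases h : γ = 0
      · subst h; simp [coeff_one_zero]
      · simp [coeff_one_of_ne h])
    (by simpa [coeff_one_zero] using norm_coeff_le (1 : tateAlgebra σ A) 0)

lemma continuous_coeff (γ : σ →₀ ℕ) : Continuous (coeff γ : tateAlgebra σ A → A) :=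
  AddMonoidHomClass.continuous_of_bound (coeff γ) 1 fun f => by
    simpa using norm_coeff_le f γ

instance [CompleteSpace A] : CompleteSpace (tateAlgebra σ A) := by
  refine Metric.complete_of_cauchySeq_tendsto fun u hu => ?_
  have hc (γ) : ∃ a, Tendsto (fun n => coeff γ (u n)) atTop (𝓝 a) := by
    refine cauchySeq_tendsto_of_complete ?_
    rw [Metric.cauchySeq_iff'] at hu ⊢
    intro ε hε
    obtain ⟨N, hN⟩ := hu ε hε
    refine ⟨N, fun n hn => lt_of_le_of_lt ?_ (hN n hn)⟩
    rw [dist_eq_norm, dist_eq_norm, ← map_sub]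
    exact norm_coeff_le _ γ
  choose a ha using hc
  have key (ε : ℝ) (hε : 0 < ε) : ∃ N, ∀ n ≥ N, ∀ γ, ‖coeff γ (u n) - a γ‖ ≤ ε := by
    obtain ⟨N, hN⟩ := Metric.cauchySeq_iff.1 hu ε hε
    refine ⟨N, fun n hn γ => ?_⟩
    refine le_of_tendsto ((tendsto_const_nhds.sub (ha γ)).norm) ?_
    filter_upwards [eventually_ge_atTop N] with k hk
    rw [← map_sub]
    exact (norm_coeff_le _ γ).trans ((dist_eq_norm (u n) (u k) ▸ hN n hn k hk).le)
  have hmem : Membership.mem (tateAlgebra σ A) (show MvPowerSeries σ A from a) := by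
    rw [mem_iff, Metric.tendsto_nhds]
    intro ε hε
    obtain ⟨N, hN⟩ := key (ε / 2) (half_pos hε)
    filter_upwards [(tendsto_norm_coeff (u N)).eventually (gt_mem_nhds hε)] with γ hγ
    have h1 : MvPowerSeries.coeff γ (show MvPowerSeries σ A from a) = a γ := rfl
    rw [dist_zero_right, norm_norm, h1,
      show a γ = coeff γ (u N) + -(coeff γ (u N) - a γ) by abel]
    refine (IsUltrametricDist.norm_add_le_max _ _).trans_lt (max_lt hγ ?_)
    rw [norm_neg]
    exact (hN N le_rfl γ).trans_lt (half_lt_self hε)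
  refine ⟨⟨a, hmem⟩, Metric.tendsto_atTop.2 fun ε hε => ?_⟩
  obtain ⟨N, hN⟩ := key (ε / 2) (half_pos hε)
  refine ⟨N, fun n hn => lt_of_le_of_lt ?_ (half_lt_self hε)⟩
  rw [dist_eq_norm]
  exact norm_le fun γ => by rw [map_sub]; exact hN n hn γ

/-- The lexicographically largest exponent at which the Gauss norm is attained. -/
lemma exists_leading [Finite σ] [LinearOrder σ] {f : tateAlgebra σ A} (hf : f ≠ 0) :
    ∃ α, ‖coeff α f‖ = ‖f‖ ∧ ∀ β, toLex α < toLex β → ‖coeff β f‖ < ‖f‖ := by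
  have hfin : {γ | ‖coeff γ f‖ = ‖f‖}.Finite :=
    (finite_le_norm_coeff f (norm_pos_iff.2 hf)).subset fun γ hγ => hγ.ge
  obtain ⟨α, hα, hmax⟩ := hfin.exists_maximalFor toLex _ (exists_norm_coeff_eq f)
  refine ⟨α, hα, fun β hβ => (norm_coeff_le f β).lt_of_ne fun h => ?_⟩
  exact hβ.not_ge (hmax h hβ.le)

end Norm

section Mul

variable {σ A : Type*} [NormedCommRing A] [IsUltrametricDist A] [NormMulClass A]

/-- In an ultrametric group, a term dominating all others determines the norm of a sum. -/
lemma _root_.IsUltrametricDist.norm_sum_eq_of_forall_lt {ι E : Type*} [NormedAddCommGroup E]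
    [IsUltrametricDist E] {s : Finset ι} {a : ι → E} {i : ι} (hi : i ∈ s)
    (h : ∀ j ∈ s, j ≠ i → ‖a j‖ < ‖a i‖) : ‖∑ j ∈ s, a j‖ = ‖a i‖ := by
  classical
  rw [← Finset.add_sum_erase s a hi]
  rcases (s.erase i).eq_empty_or_nonempty with he | he
  · simp [he]
  · obtain ⟨j, hj, hle⟩ := IsUltrametricDist.exists_norm_finsetSum_le_of_nonempty he a
    have hlt := hle.trans_lt (h j (Finset.mem_of_mem_erase hj) (Finset.ne_of_mem_erase hj))
    rw [IsUltrametricDist.norm_add_eq_max_of_norm_ne_norm hlt.ne', max_eq_left hlt.le]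

/-- Leading coefficients multiply without cancellation. -/
lemma norm_coeff_add_mul [Finite σ] [LinearOrder σ] {f g : tateAlgebra σ A} {α β : σ →₀ ℕ}
    (hg0 : g ≠ 0) (hf0 : f ≠ 0)
    (hα : ‖coeff α f‖ = ‖f‖) (hα' : ∀ γ, toLex α < toLex γ → ‖coeff γ f‖ < ‖f‖)
    (hβ : ‖coeff β g‖ = ‖g‖) (hβ' : ∀ γ, toLex β < toLex γ → ‖coeff γ g‖ < ‖g‖) :
    ‖coeff (α + β) (f * g)‖ = ‖f‖ * ‖g‖ := by
  have hf := norm_pos_iff.2 hf0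
  have hg := norm_pos_iff.2 hg0
  rw [coeff_mul, IsUltrametricDist.norm_sum_eq_of_forall_lt (i := (α, β)) (by simp), norm_mul, hα,
    hβ]
  rintro ⟨i, j⟩ hij hne
  rw [Finset.HasAntidiagonal.mem_antidiagonal] at hij
  simp only [norm_mul, hα, hβ]
  by_cases h : toLex α < toLex i
  · exact (mul_le_mul_of_nonneg_left (norm_coeff_le g j) (norm_nonneg _)).trans_lt
      (mul_lt_mul_of_pos_right (hα' i h) hg)
  · have h' : toLex β < toLex j := by
      by_contra hj
      rw [not_lt] at h hj
      have hsum : toLex i + toLex j = toLex α + toLex β := congrArg toLex hij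
      obtain ⟨h1, h2⟩ := (add_eq_add_iff_eq_and_eq h hj).1 hsum
      exact hne (by rw [toLex.injective h1, toLex.injective h2])
    exact (mul_le_mul_of_nonneg_right (norm_coeff_le f i) (norm_nonneg _)).trans_lt
      (mul_lt_mul_of_pos_left (hβ' j h') hf)

instance [Finite σ] : NormMulClass (tateAlgebra σ A) where
  norm_mul f g := by
    rcases eq_or_ne f 0 with rfl | hf
    · simp
    rcases eq_or_ne g 0 with rfl | hg
    · simp
    classical
    let : LinearOrder σ := linearOrderOfSTO WellOrderingRel
    obtain ⟨α, hα, hα'⟩ := exists_leading hf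
    obtain ⟨β, hβ, hβ'⟩ := exists_leading hg
    exact le_antisymm (norm_mul_le f g)
      (norm_coeff_add_mul hg hf hα hα' hβ hβ' ▸ norm_coeff_le _ _)

/-- The constant term of a unit is its dominant coefficient. -/
lemma norm_coeff_zero_of_isUnit [Finite σ] [Nontrivial A] {u : tateAlgebra σ A} (hu : IsUnit u) :
    ‖coeff 0 u‖ = ‖u‖ := by
  obtain ⟨w, hw⟩ := hu.exists_right_inv
  have h1 : (1 : tateAlgebra σ A) ≠ 0 := fun h => by
    simpa [coeff_one_zero] using congrArg (coeff 0) h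
  have hu0 : u ≠ 0 := fun h => h1 (by rw [← hw, h, zero_mul])
  have hw0 : w ≠ 0 := fun h => h1 (by rw [← hw, h, mul_zero])
  classical
  let : LinearOrder σ := linearOrderOfSTO WellOrderingRel
  obtain ⟨α, hα, hα'⟩ := exists_leading hu0
  obtain ⟨β, hβ, hβ'⟩ := exists_leading hw0
  have h := norm_coeff_add_mul hw0 hu0 hα hα' hβ hβ'
  have h0 : α + β = 0 := by
    by_contra hne
    rw [hw, coeff_one_of_ne hne, norm_zero] at h
    exact mul_ne_zero (norm_ne_zero_iff.2 hu0) (norm_ne_zero_iff.2 hw0) h.symm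
  rwa [(add_eq_zero.1 h0).1] at hα

instance [Finite σ] [Nontrivial A] : IsDomain (tateAlgebra σ A) := by
  have : Nontrivial (tateAlgebra σ A) := ⟨1, 0, fun h => by
    simpa [coeff_one_zero] using congrArg (coeff 0) h⟩
  have : NoZeroDivisors (tateAlgebra σ A) := NormMulClass.toNoZeroDivisors
  exact NoZeroDivisors.to_isDomain _

end Mul

section Polynomial

variable {σ A : Type*} [NormedCommRing A] [IsUltrametricDist A]

/-- Polynomials as elements of the Tate algebra. -/
noncomputable def ofMvPolynomial : MvPolynomial σ A →+* tateAlgebra σ A :=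
  MvPolynomial.coeToMvPowerSeries.ringHom.codRestrict _ fun p => mem_iff.2 <|
    tendsto_nhds_of_eventually_eq <| p.support.finite_toSet.subset fun γ hγ => by
      simpa using hγ

lemma coeff_ofMvPolynomial (γ : σ →₀ ℕ) (p : MvPolynomial σ A) :
    coeff γ (ofMvPolynomial p) = p.coeff γ := MvPolynomial.coeff_coe p γ

/-- For `ε > 0`, an element of the Tate algebra is within `ε` of the polynomial formed by its
terms of norm at least `ε`. -/
lemma exists_norm_sub_ofMvPolynomial_lt (f : tateAlgebra σ A) {ε : ℝ} (hε : 0 < ε) :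
    ∃ p : MvPolynomial σ A, ‖f - ofMvPolynomial p‖ < ε ∧
      (∀ γ ∈ p.support, p.coeff γ = coeff γ f ∧ ε ≤ ‖coeff γ f‖) := by
  classical
  have hfin := finite_le_norm_coeff f hε
  have hp (γ) : (∑ γ ∈ hfin.toFinset, MvPolynomial.monomial γ (coeff γ f)).coeff γ =
      if ε ≤ ‖coeff γ f‖ then coeff γ f else 0 := by
    simp [MvPolynomial.coeff_sum, MvPolynomial.coeff_monomial]
  refine ⟨∑ γ ∈ hfin.toFinset, MvPolynomial.monomial γ (coeff γ f), norm_lt fun γ => ?_,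
    fun γ hγ => ?_⟩
  · rw [map_sub, coeff_ofMvPolynomial, hp]
    split_ifs with h
    · simpa using hε
    · simpa using h
  · rw [MvPolynomial.mem_support_iff, hp] at hγ
    rw [hp]
    split_ifs at hγ ⊢ with h
    · exact ⟨rfl, h⟩
    · exact absurd rfl hγ

lemma denseRange_ofMvPolynomial : DenseRange (ofMvPolynomial : MvPolynomial σ A → _) := by
  refine Metric.denseRange_iff.2 fun f ε hε => ?_
  obtain ⟨p, hp, -⟩ := exists_norm_sub_ofMvPolynomial_lt f hε
  exact ⟨p, by rwa [dist_eq_norm]⟩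

end Polynomial

end tateAlgebra

/-! ### Dense subrings and Tate algebras in one variable -/

/-- Two isometric copies of a ring, dense in complete normed rings, extend to an isometric
isomorphism of these rings. -/
lemma exists_ringEquiv_of_denseRange {P B₁ B₂ : Type*} [CommRing P] [NormedCommRing B₁]
    [NormedCommRing B₂] [CompleteSpace B₁] [CompleteSpace B₂] (φ₁ : P →+* B₁) (φ₂ : P →+* B₂)
    (h₁ : DenseRange φ₁) (h₂ : DenseRange φ₂) (h : ∀ p, ‖φ₁ p‖ = ‖φ₂ p‖) :
    ∃ e : B₁ ≃+* B₂, (∀ p, e (φ₁ p) = φ₂ p) ∧ ∀ x, ‖e x‖ = ‖x‖ := by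
  let : UniformSpace P := UniformSpace.comap φ₁ inferInstance
  have ui : IsUniformInducing φ₁ := ⟨rfl⟩
  have huc : UniformContinuous φ₂ := by
    refine ((ui.basis_uniformity Metric.uniformity_basis_dist).uniformContinuous_iff
      Metric.uniformity_basis_dist).2 fun ε hε => ⟨ε, hε, fun p q hpq => ?_⟩
    change dist (φ₁ p) (φ₁ q) < ε at hpq
    change dist (φ₂ p) (φ₂ q) < ε
    rwa [dist_eq_norm, ← map_sub, ← h, map_sub, ← dist_eq_norm]
  let Φ : B₁ →+* B₂ := IsDenseInducing.extendRingHom ui h₁ huc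
  have hc : Continuous Φ := (uniformContinuous_uniformly_extend ui h₁ huc).continuous
  have hΦ (p) : Φ (φ₁ p) = φ₂ p :=
    IsDenseInducing.extend_eq (ui.isDenseInducing h₁) huc.continuous p
  have hn (x) : ‖Φ x‖ = ‖x‖ := by
    refine DenseRange.induction_on h₁ x (isClosed_eq hc.norm continuous_norm) fun p => ?_
    rw [hΦ, h]
  have hiso : Isometry Φ := AddMonoidHomClass.isometry_of_norm Φ hn
  have hsurj : Function.Surjective Φ := by
    have : IsClosed (Set.range Φ) := hiso.isClosedEmbedding.isClosed_range
    rw [← Set.range_eq_univ, ← this.closure_eq, ← Set.univ_subset_iff, ← h₂.closure_range]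
    refine closure_mono ?_
    rintro _ ⟨p, rfl⟩
    exact ⟨φ₁ p, hΦ p⟩
  exact ⟨RingEquiv.ofBijective Φ ⟨hiso.injective, hsurj⟩, hΦ, hn⟩

namespace tateAlgebra

section OneVariable

open Polynomial

variable {A : Type*} [NormedCommRing A] [IsUltrametricDist A]

/-- The coefficients of an element of a Tate algebra in one variable, indexed by `ℕ`. -/
noncomputable def coeffNat (n : ℕ) : tateAlgebra Unit A →+ A := coeff (Finsupp.single () n)

lemma coeffNat_mul (n : ℕ) (f g : tateAlgebra Unit A) :
    coeffNat n (f * g) =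
      ∑ p ∈ Finset.HasAntidiagonal.antidiagonal n, coeffNat p.1 f * coeffNat p.2 g :=
  PowerSeries.coeff_mul n f.1 g.1

lemma coeff_eq_coeffNat (γ : Unit →₀ ℕ) (f : tateAlgebra Unit A) :
    coeff γ f = coeffNat (γ ()) f := by
  rw [coeffNat, ← Finsupp.unique_single]

lemma ext_coeffNat {f g : tateAlgebra Unit A} (h : ∀ n, coeffNat n f = coeffNat n g) : f = g :=
  ext fun γ => by simp only [coeff_eq_coeffNat, h]

lemma norm_coeffNat_le (f : tateAlgebra Unit A) (n : ℕ) : ‖coeffNat n f‖ ≤ ‖f‖ :=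
  norm_coeff_le f _

lemma norm_le_of_coeffNat {f : tateAlgebra Unit A} {C : ℝ} (h : ∀ n, ‖coeffNat n f‖ ≤ C) :
    ‖f‖ ≤ C := norm_le fun γ => by simpa only [coeff_eq_coeffNat] using h _

lemma norm_lt_of_coeffNat {f : tateAlgebra Unit A} {C : ℝ} (h : ∀ n, ‖coeffNat n f‖ < C) :
    ‖f‖ < C := norm_lt fun γ => by simpa only [coeff_eq_coeffNat] using h _

/-- The largest index at which the Gauss norm is attained. -/
lemma exists_leading_coeffNat {f : tateAlgebra Unit A} (hf : f ≠ 0) :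
    ∃ k, ‖coeffNat k f‖ = ‖f‖ ∧ ∀ n, k < n → ‖coeffNat n f‖ < ‖f‖ := by
  have hfin : {n | ‖coeffNat n f‖ = ‖f‖}.Finite := by
    refine ((finite_le_norm_coeff f (norm_pos_iff.2 hf)).preimage
      (Finsupp.single_injective ()).injOn).subset fun n hn => (show _ = _ from hn).ge
  obtain ⟨γ, hγ⟩ := exists_norm_coeff_eq f
  rw [coeff_eq_coeffNat] at hγ
  obtain ⟨k, hk, hmax⟩ := hfin.exists_maximalFor id _ ⟨_, hγ⟩
  refine ⟨k, hk, fun n hn => (norm_coeffNat_le f n).lt_of_ne fun h => ?_⟩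
  exact hn.not_ge (hmax h hn.le)

/-- Polynomials in one variable as elements of the Tate algebra. -/
noncomputable def ofPolynomial : A[X] →+* tateAlgebra Unit A :=
  (Polynomial.coeToPowerSeries.ringHom (R := A)).codRestrict (tateAlgebra Unit A) fun p =>
    mem_iff.2 <| tendsto_nhds_of_eventually_eq <|
      ((p.support.finite_toSet.preimage (f := fun γ : Unit →₀ ℕ => γ ())
        (fun a _ b _ h => Finsupp.ext fun _ => h))).subset fun γ hγ => by
          have h : MvPowerSeries.coeff γ (p : PowerSeries A) = p.coeff (γ ()) := by
            rw [← Polynomial.coeff_coe, PowerSeries.coeff, ← Finsupp.unique_single]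
          simpa [h] using hγ

lemma coeffNat_ofPolynomial (n : ℕ) (p : A[X]) : coeffNat n (ofPolynomial p) = p.coeff n :=
  Polynomial.coeff_coe p n

lemma ofPolynomial_injective : Function.Injective (ofPolynomial : A[X] → tateAlgebra Unit A) :=
  fun p q h => Polynomial.ext fun n => by
    rw [← coeffNat_ofPolynomial, h, coeffNat_ofPolynomial]

lemma denseRange_ofPolynomial : DenseRange (ofPolynomial : A[X] → tateAlgebra Unit A) := by
  refine Metric.denseRange_iff.2 fun f ε hε => ?_
  have hfin := (finite_le_norm_coeff f hε).preimage
      (f := fun n : ℕ => Finsupp.single () n) (Finsupp.single_injective ()).injOn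
  refine ⟨∑ n ∈ hfin.toFinset, Polynomial.monomial n (coeffNat n f), ?_⟩
  rw [dist_eq_norm]
  refine norm_lt_of_coeffNat fun n => ?_
  rw [map_sub, coeffNat_ofPolynomial]
  simp only [finsetSum_coeff, coeff_monomial, Finset.sum_ite_eq', Set.Finite.mem_toFinset]
  split_ifs with h
  · simpa using hε
  · simpa [coeffNat] using h

end OneVariable

end tateAlgebra

/-! ### Weierstrass division -/

namespace tateAlgebra

section Weierstrass

open Polynomial

variable {A : Type*} [NormedCommRing A] [IsUltrametricDist A]

/-- An element of the Tate algebra in one variable is distinguished of degree `s` if it has Gauss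
norm at most one, its coefficient of index `s` is a unit of norm one, and all later coefficients
have norm less than one. -/
structure IsDistinguished (s : ℕ) (g : tateAlgebra Unit A) : Prop where
  isUnit : IsUnit (coeffNat s g)
  norm_coeff : ‖coeffNat s g‖ = 1
  norm_le : ‖g‖ ≤ 1
  norm_lt : ∀ n, s < n → ‖coeffNat n g‖ < 1

lemma norm_ofPolynomial_le {p : A[X]} {C : ℝ} (h : ∀ n, ‖p.coeff n‖ ≤ C) :
    ‖ofPolynomial p‖ ≤ C :=
  norm_le_of_coeffNat fun n => by rw [coeffNat_ofPolynomial]; exact h n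

lemma coeffNat_ofPolynomial_of_degree_lt {p : A[X]} {s n : ℕ} (hp : p.degree < s) (hn : s ≤ n) :
    coeffNat n (ofPolynomial p) = 0 := by
  rw [coeffNat_ofPolynomial]
  exact coeff_eq_zero_of_degree_lt (hp.trans_le (by exact_mod_cast hn))

lemma isDistinguished_ofPolynomial [NormOneClass A] {p : A[X]} (hp : p.Monic)
    (hn : ‖ofPolynomial p‖ ≤ 1) : IsDistinguished p.natDegree (ofPolynomial p) where
  isUnit := by rw [coeffNat_ofPolynomial, hp.coeff_natDegree]; exact isUnit_one
  norm_coeff := by rw [coeffNat_ofPolynomial, hp.coeff_natDegree, norm_one]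
  norm_le := hn
  norm_lt n h := by
    rw [coeffNat_ofPolynomial, coeff_eq_zero_of_natDegree_lt h, norm_zero]
    exact one_pos

lemma one_le_norm_ofPolynomial [NormOneClass A] {p : A[X]} (hp : p.Monic) :
    1 ≤ ‖ofPolynomial p‖ := by
  have := norm_coeffNat_le (ofPolynomial p) p.natDegree
  rwa [coeffNat_ofPolynomial, hp.coeff_natDegree, norm_one] at this

variable [NormMulClass A]

/-- Dividing by a distinguished element does not increase the norm: the leading coefficient of `q`
times the distinguished coefficient of `g` survives in `q * g + r`. This single estimate gives
uniqueness of Weierstrass division, and closedness of the set of all `q * g + r`. -/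
lemma IsDistinguished.norm_le_norm_mul_add {s : ℕ} {g : tateAlgebra Unit A}
    (hg : IsDistinguished s g) (q : tateAlgebra Unit A) {r : tateAlgebra Unit A}
    (hr : ∀ n, s ≤ n → coeffNat n r = 0) : ‖q‖ ≤ ‖q * g + r‖ := by
  rcases eq_or_ne q 0 with rfl | hq
  · simp
  have hq' := norm_pos_iff.2 hq
  obtain ⟨k, hk, hk'⟩ := exists_leading_coeffNat hq
  refine le_trans (le_of_eq ?_) (norm_coeffNat_le (q * g + r) (k + s))
  rw [map_add, hr _ (Nat.le_add_left s k), add_zero, coeffNat_mul,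
    IsUltrametricDist.norm_sum_eq_of_forall_lt (i := (k, s)) (by simp), norm_mul, hk,
    hg.norm_coeff, mul_one]
  rintro ⟨i, j⟩ hij hne
  rw [Finset.HasAntidiagonal.mem_antidiagonal] at hij
  simp only [norm_mul, hk, hg.norm_coeff, mul_one]
  rcases lt_or_ge k i with h | h
  · calc _ ≤ ‖coeffNat i q‖ * 1 :=
        mul_le_mul_of_nonneg_left ((norm_coeffNat_le g j).trans hg.norm_le) (norm_nonneg _)
      _ < ‖q‖ := by rw [mul_one]; exact hk' i h
  · have hj : s < j := by
      by_contra! hj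
      exact hne (by ext <;> simp at hij ⊢ <;> omega)
    calc _ ≤ ‖q‖ * ‖coeffNat j g‖ :=
        mul_le_mul_of_nonneg_right (norm_coeffNat_le q i) (norm_nonneg _)
      _ < ‖q‖ := mul_lt_of_lt_one_right hq' (hg.norm_lt j hj)

/-- The additive subgroup of all `q * g + r` with `r` a polynomial of degree less than `s`. -/
def divisionRange (s : ℕ) (g : tateAlgebra Unit A) : AddSubgroup (tateAlgebra Unit A) where
  carrier := {f | ∃ q, ∀ n, s ≤ n → coeffNat n (f - q * g) = 0}
  zero_mem' := ⟨0, fun n _ => by simp⟩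
  add_mem' := by
    rintro f f' ⟨q, hq⟩ ⟨q', hq'⟩
    refine ⟨q + q', fun n hn => ?_⟩
    rw [show f + f' - (q + q') * g = (f - q * g) + (f' - q' * g) by ring, map_add, hq n hn,
      hq' n hn, add_zero]
  neg_mem' := by
    rintro f ⟨q, hq⟩
    refine ⟨-q, fun n hn => ?_⟩
    rw [show -f - -q * g = -(f - q * g) by ring, map_neg, hq n hn, neg_zero]

lemma IsDistinguished.isClosed_divisionRange [CompleteSpace A] {s : ℕ} {g : tateAlgebra Unit A}
    (hg : IsDistinguished s g) : IsClosed (divisionRange s g : Set (tateAlgebra Unit A)) := by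
  refine isClosed_of_closure_subset fun f hf => ?_
  obtain ⟨u, hu, hlim⟩ := mem_closure_iff_seq_limit.1 hf
  choose q hq using hu
  have hcau : CauchySeq q := by
    refine Metric.cauchySeq_iff.2 fun ε hε => ?_
    obtain ⟨N, hN⟩ := Metric.cauchySeq_iff.1 hlim.cauchySeq ε hε
    refine ⟨N, fun m hm n hn => lt_of_le_of_lt ?_ (hN m hm n hn)⟩
    rw [dist_eq_norm, dist_eq_norm]
    have := hg.norm_le_norm_mul_add (q m - q n) (r := (u m - q m * g) - (u n - q n * g))
      fun k hk => by rw [map_sub, hq m k hk, hq n k hk, sub_zero]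
    rwa [show (q m - q n) * g + ((u m - q m * g) - (u n - q n * g)) = u m - u n by ring] at this
  obtain ⟨q₀, hq₀⟩ := cauchySeq_tendsto_of_complete hcau
  refine ⟨q₀, fun n hn => ?_⟩
  have h1 : Tendsto (fun k => coeffNat n (u k - q k * g)) atTop (𝓝 (coeffNat n (f - q₀ * g))) :=
    ((continuous_coeff _).tendsto _).comp (hlim.sub (hq₀.mul_const g))
  exact tendsto_nhds_unique h1 (by simp [hq _ n hn])

/-- Euclidean division by the polynomial part of a distinguished element approximates
Weierstrass division. -/
lemma IsDistinguished.exists_approx_division {s : ℕ} {g : tateAlgebra Unit A}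
    (hg : IsDistinguished s g) : ∃ ε < (1 : ℝ), 0 < ε ∧ ∀ f : tateAlgebra Unit A,
      ∃ k ∈ divisionRange s g, ‖f - k‖ ≤ ε * ‖f‖ := by
  set p : A[X] := ∑ i ∈ Finset.range (s + 1), monomial i (coeffNat i g) with hp
  have hcoeff (n) : p.coeff n = if n ≤ s then coeffNat n g else 0 := by
    simp [hp, finsetSum_coeff, coeff_monomial, Finset.sum_ite_eq']
  have hgp : ‖g - ofPolynomial p‖ < 1 := norm_lt_of_coeffNat fun n => by
    rw [map_sub, coeffNat_ofPolynomial, hcoeff]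
    split_ifs with h
    · simp
    · simpa using hg.norm_lt n (not_le.1 h)
  have hpd : IsDistinguished s (ofPolynomial p) := by
    refine ⟨?_, ?_, norm_ofPolynomial_le fun n => ?_, fun n hn => ?_⟩
    · simpa [coeffNat_ofPolynomial, hcoeff] using hg.isUnit
    · simpa [coeffNat_ofPolynomial, hcoeff] using hg.norm_coeff
    · rw [hcoeff]
      split_ifs
      · exact (norm_coeffNat_le g n).trans hg.norm_le
      · simp
    · simp [coeffNat_ofPolynomial, hcoeff, hn.not_ge]
  obtain ⟨u, hu⟩ := hg.isUnit
  -- the monic polynomial proportional to `p`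
  set P : A[X] := C (↑u⁻¹ : A) * p with hP
  have hpP : p = C (u : A) * P := by rw [hP, ← mul_assoc, ← C_mul]; simp
  have hPdeg : P.natDegree ≤ s := by
    rw [natDegree_le_iff_coeff_eq_zero]
    intro n hn
    simp [hP, hcoeff, hn.not_ge]
  have hPmonic : P.Monic := monic_of_natDegree_le_of_coeff_eq_one s hPdeg (by
    simp [hP, hcoeff, ← hu])
  have : Nontrivial A := ⟨⟨coeffNat s g, 0, fun h => by simpa [h] using hg.norm_coeff⟩⟩
  have hPdeg' : P.degree ≤ s := degree_le_of_natDegree_le hPdeg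
  refine ⟨max (1 / 2) ‖g - ofPolynomial p‖, max_lt (by norm_num) hgp, by positivity, fun f => ?_⟩
  rcases eq_or_ne f 0 with rfl | hf
  · exact ⟨0, zero_mem _, by simp⟩
  have hf' := norm_pos_iff.2 hf
  obtain ⟨F, hF⟩ := Metric.denseRange_iff.1 denseRange_ofPolynomial f _ (half_pos hf')
  rw [dist_eq_norm] at hF
  have hFn : ‖ofPolynomial F‖ ≤ ‖f‖ := by
    rw [show ofPolynomial F = f + -(f - ofPolynomial F) by abel]
    refine (norm_add_le_max _ _).trans (max_le le_rfl ?_)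
    rw [norm_neg]
    exact hF.le.trans (half_le_self hf'.le)
  set q : A[X] := C (↑u⁻¹ : A) * (F /ₘ P) with hq
  set r : A[X] := F %ₘ P with hr
  have hqr : F = q * p + r := by
    conv_lhs => rw [← modByMonic_add_div F P]
    rw [hq, hpP, hr, add_comm, mul_mul_mul_comm, ← C_mul]
    simp [mul_comm]
  have hrs : ∀ n, s ≤ n → coeffNat n (ofPolynomial r) = 0 := fun n =>
    coeffNat_ofPolynomial_of_degree_lt ((degree_modByMonic_lt F hPmonic).trans_le hPdeg')
  have hqn : ‖ofPolynomial q‖ ≤ ‖f‖ := by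
    refine (hpd.norm_le_norm_mul_add (ofPolynomial q) hrs).trans ?_
    rwa [← map_mul, ← map_add, ← hqr]
  clear_value q r
  refine ⟨ofPolynomial q * g + ofPolynomial r, ⟨ofPolynomial q, fun n hn => ?_⟩, ?_⟩
  · rw [add_sub_cancel_left, hrs n hn]
  · have : f - (ofPolynomial q * g + ofPolynomial r) =
        (f - ofPolynomial F) + -(ofPolynomial q * (g - ofPolynomial p)) := by
      rw [hqr, map_add, map_mul]; ring
    rw [this]
    refine (norm_add_le_max _ _).trans (max_le ?_ ?_)
    · calc _ ≤ 1 / 2 * ‖f‖ := by linarith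
        _ ≤ _ := mul_le_mul_of_nonneg_right (le_max_left _ _) hf'.le
    · rw [norm_neg, norm_mul, mul_comm]
      exact mul_le_mul (le_max_right _ _) hqn (norm_nonneg _) (by positivity)

/-- **Weierstrass division**. -/
theorem IsDistinguished.exists_eq_mul_add [CompleteSpace A] {s : ℕ} {g : tateAlgebra Unit A}
    (hg : IsDistinguished s g) (f : tateAlgebra Unit A) :
    ∃ (q : tateAlgebra Unit A) (r : A[X]), r.degree < s ∧ f = q * g + ofPolynomial r := by
  obtain ⟨ε, hε1, hε0, happ⟩ := hg.exists_approx_division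
  have hiter (n : ℕ) : ∃ k ∈ divisionRange s g, ‖f - k‖ ≤ ε ^ n * ‖f‖ := by
    induction n with
    | zero => exact ⟨0, zero_mem _, by simp⟩
    | succ n ih =>
      obtain ⟨k, hk, hkn⟩ := ih
      obtain ⟨k', hk', hkn'⟩ := happ (f - k)
      refine ⟨k + k', add_mem hk hk', ?_⟩
      rw [← sub_sub, pow_succ', mul_assoc]
      exact hkn'.trans (mul_le_mul_of_nonneg_left hkn hε0.le)
  have hmem : f ∈ divisionRange s g := by
    change f ∈ (divisionRange s g : Set (tateAlgebra Unit A))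
    rw [← hg.isClosed_divisionRange.closure_eq, Metric.mem_closure_iff]
    intro δ hδ
    have hlim : Tendsto (fun n => ε ^ n * ‖f‖) atTop (𝓝 0) := by
      simpa using (tendsto_pow_atTop_nhds_zero_of_lt_one hε0.le hε1).mul_const ‖f‖
    obtain ⟨n, hn⟩ := (hlim.eventually (gt_mem_nhds hδ)).exists
    obtain ⟨k, hk, hkn⟩ := hiter n
    exact ⟨k, hk, by rw [dist_eq_norm]; exact hkn.trans_lt hn⟩
  obtain ⟨q, hq⟩ := hmem
  refine ⟨q, ∑ i ∈ Finset.range s, monomial i (coeffNat i (f - q * g)), ?_, ?_⟩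
  · refine (degree_lt_iff_coeff_zero _ _).2 fun n hn => ?_
    simp only [finsetSum_coeff, coeff_monomial, Finset.sum_ite_eq', Finset.mem_range, hn.not_gt,
      if_false]
  · rw [← sub_eq_iff_eq_add']
    refine ext_coeffNat fun n => ?_
    rw [coeffNat_ofPolynomial]
    simp only [finsetSum_coeff, coeff_monomial, Finset.sum_ite_eq', Finset.mem_range]
    split_ifs with h
    · rfl
    · exact hq n (not_lt.1 h)

/-- A remainder divisible by the distinguished divisor vanishes. -/
lemma IsDistinguished.eq_zero_of_dvd {s : ℕ} {g : tateAlgebra Unit A}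
    (hg : IsDistinguished s g) {r : A[X]} (hr : r.degree < s) (h : g ∣ ofPolynomial r) :
    r = 0 := by
  obtain ⟨v, hv⟩ := h
  have h1 := hg.norm_le_norm_mul_add (-v) (r := ofPolynomial r)
    fun n => coeffNat_ofPolynomial_of_degree_lt hr
  rw [hv, mul_comm g v, neg_mul, neg_add_cancel, norm_zero, norm_neg, norm_le_zero_iff] at h1
  refine ofPolynomial_injective ?_
  rw [hv, h1, mul_zero, map_zero]

/-- A monic prime polynomial of Gauss norm one remains prime in the Tate algebra, because
Weierstrass division identifies the two quotient rings. -/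
lemma prime_ofPolynomial [CompleteSpace A] [NormOneClass A] {p : A[X]} (hp : p.Monic)
    (hn : ‖ofPolynomial p‖ ≤ 1) (hprime : Prime p) : Prime (ofPolynomial p) := by
  have : Nontrivial A := ⟨1, 0, fun h => hprime.ne_zero (by
    have := hp.leadingCoeff; rw [← mul_one p, ← C_1, h, C_0, mul_zero])⟩
  have hd := isDistinguished_ofPolynomial hp hn
  have hdeg : p.degree = p.natDegree := degree_eq_natDegree hprime.ne_zero
  -- divisibility of polynomials by `p` may be tested in the Tate algebra
  have key (a : A[X]) (ha : ofPolynomial p ∣ ofPolynomial a) : p ∣ a := by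
    rw [← modByMonic_eq_zero_iff_dvd hp]
    refine hd.eq_zero_of_dvd (hdeg ▸ degree_modByMonic_lt a hp) ?_
    rw [modByMonic_eq_sub_mul_div, map_sub, map_mul]
    exact dvd_sub ha (dvd_mul_right _ _)
  refine ⟨fun h => hprime.ne_zero (ofPolynomial_injective (h.trans (map_zero _).symm)),
    fun h => hprime.not_isUnit (isUnit_of_dvd_one (key 1 (by rw [map_one]; exact h.dvd))),
    fun a b hab => ?_⟩
  obtain ⟨q₁, r₁, -, rfl⟩ := hd.exists_eq_mul_add a
  obtain ⟨q₂, r₂, -, rfl⟩ := hd.exists_eq_mul_add b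
  have h : ofPolynomial p ∣ ofPolynomial (r₁ * r₂) := by
    have := dvd_sub hab (dvd_mul_left (ofPolynomial p)
      (q₁ * q₂ * ofPolynomial p + q₁ * ofPolynomial r₂ + ofPolynomial r₁ * q₂))
    rw [map_mul]
    convert this using 1
    ring
  refine (hprime.dvd_or_dvd (key _ h)).imp (fun h => ?_) fun h => ?_ <;>
  exact dvd_add (dvd_mul_left _ _) (map_dvd ofPolynomial h)

/-- A monic polynomial of Gauss norm one is a product of primes in the Tate algebra. -/
lemma ofPolynomial_mem_closure [CompleteSpace A] [IsDomain A] [NormOneClass A]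
    [UniqueFactorizationMonoid A] {p : A[X]} (hp : p.Monic) (hn : ‖ofPolynomial p‖ ≤ 1) :
    ofPolynomial p ∈ Submonoid.closure {x : tateAlgebra Unit A | IsUnit x ∨ Prime x} := by
  induction hd : p.natDegree using Nat.strong_induction_on generalizing p with
  | _ d ih =>
  subst hd
  rcases Nat.eq_zero_or_pos p.natDegree with h0 | hpos
  · rw [hp.natDegree_eq_zero.1 h0, map_one]
    exact one_mem _
  have hnu : ¬ IsUnit p := fun h => hpos.ne' (natDegree_eq_zero_of_isUnit h)
  obtain ⟨π, hπ, hdvd⟩ := WfDvdMonoid.exists_irreducible_factor hnu hp.ne_zero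
  -- normalise the irreducible factor to be monic
  have hlc : IsUnit π.leadingCoeff :=
    isUnit_of_dvd_one (hp.leadingCoeff ▸ leadingCoeff_dvd_leadingCoeff hdvd)
  obtain ⟨u, hu⟩ := hlc
  have hass : Associated π (C (↑u⁻¹ : A) * π) :=
    (associated_unit_mul_left π _ ((u⁻¹).isUnit.map C)).symm
  have hmonic : (C (↑u⁻¹ : A) * π).Monic := by
    rw [Monic, leadingCoeff_mul, leadingCoeff_C, ← hu, Units.inv_mul]
  have hprime : Prime (C (↑u⁻¹ : A) * π) := hass.prime hπ.prime
  generalize C (↑u⁻¹ : A) * π = ϖ at hass hmonic hprime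
  obtain ⟨η, rfl⟩ := hass.dvd_iff_dvd_left.1 hdvd
  have hη : η.Monic := hmonic.of_mul_monic_left hp
  rw [map_mul, norm_mul] at hn
  have h1 := one_le_norm_ofPolynomial hmonic
  have h2 := one_le_norm_ofPolynomial hη
  have hdeg : 0 < ϖ.natDegree := by
    refine Nat.pos_of_ne_zero fun h => hprime.not_isUnit ?_
    rw [hmonic.natDegree_eq_zero.1 h]
    exact isUnit_one
  rw [map_mul]
  refine mul_mem (Submonoid.subset_closure (Or.inr (prime_ofPolynomial hmonic ?_ hprime)))
    (ih _ ?_ hη ?_ rfl)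
  · nlinarith
  · rw [hmonic.natDegree_mul hη]; omega
  · nlinarith

/-- A distinguished element divides a monic polynomial of Gauss norm one, hence is a product of
primes. -/
theorem IsDistinguished.mem_closure [CompleteSpace A] [IsDomain A] [NormOneClass A]
    [UniqueFactorizationMonoid A] {s : ℕ} {g : tateAlgebra Unit A} (hg : IsDistinguished s g) :
    g ∈ Submonoid.closure {x : tateAlgebra Unit A | IsUnit x ∨ Prime x} := by
  obtain ⟨q, r, hr, h⟩ := hg.exists_eq_mul_add (ofPolynomial (X ^ s))
  have hX : ‖ofPolynomial (X ^ s : A[X])‖ ≤ 1 := norm_ofPolynomial_le fun n => by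
    rw [coeff_X_pow]; split_ifs <;> simp
  have hq : ‖q‖ ≤ 1 := by
    refine (hg.norm_le_norm_mul_add q fun n => coeffNat_ofPolynomial_of_degree_lt hr).trans ?_
    rwa [← h]
  have hω : q * g = ofPolynomial (X ^ s - r) := by rw [map_sub, h]; ring
  have hmem := ofPolynomial_mem_closure (monic_X_pow_sub (n := s) hr) (by
    rw [← hω, norm_mul]
    exact mul_le_one₀ hq (norm_nonneg _) hg.norm_le)
  rw [← hω, mul_comm] at hmem
  exact divisor_closure_eq_closure g q hmem

end Weierstrass

end tateAlgebra

/-! ### The shear making an element distinguished -/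

namespace tateAlgebra

section Shear

open Polynomial

variable {F : Type*} [Field F] {m : ℕ}

/-- The substitution `X 0 ↦ X 0`, `X i ↦ X i + c • X 0 ^ (B ^ i)` for `i ≠ 0`. -/
noncomputable def shearHom (m B : ℕ) (c : F) :
    MvPolynomial (Fin (m + 1)) F →ₐ[F] MvPolynomial (Fin (m + 1)) F :=
  MvPolynomial.aeval fun i =>
    if i = 0 then MvPolynomial.X 0 else MvPolynomial.X i + c • MvPolynomial.X 0 ^ B ^ (i : ℕ)

lemma shearHom_comp_neg (B : ℕ) (c : F) :
    (shearHom m B c).comp (shearHom m B (-c)) = AlgHom.id _ _ := by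
  rw [shearHom, shearHom, MvPolynomial.comp_aeval, ← MvPolynomial.aeval_X_left]
  ext i v
  cases i using Fin.cases <;> simp

/-- The automorphism `X 0 ↦ X 0`, `X i ↦ X i + X 0 ^ (B ^ i)` for `i ≠ 0` of the polynomial ring
that is used in Nagata's proof of Noether normalization. -/
noncomputable def shear (F : Type*) [Field F] (m B : ℕ) :
    MvPolynomial (Fin (m + 1)) F ≃ₐ[F] MvPolynomial (Fin (m + 1)) F :=
  AlgEquiv.ofAlgHom (shearHom m B 1) (shearHom m B (-1)) (shearHom_comp_neg B 1)
    (by simpa using shearHom_comp_neg (m := m) B (-1 : F))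

/-- The degree in `X 0` of the image under `shear` of the monomial with exponent `γ`. -/
def shearWeight (B : ℕ) (γ : Fin (m + 1) →₀ ℕ) : ℕ := ∑ i : Fin (m + 1), B ^ (i : ℕ) * γ i

/-- Exponents are the digits in base `B` of their weight. -/
lemma shearWeight_injOn {B : ℕ} (hB : 1 < B) {v w : Fin (m + 1) →₀ ℕ} (hv : ∀ i, v i < B)
    (hw : ∀ i, w i < B) (h : shearWeight B v = shearWeight B w) : v = w := by
  have hlt {v : Fin (m + 1) →₀ ℕ} (hv : ∀ i, v i < B) : ∀ l ∈ List.ofFn v, l < B := by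
    intro l hl
    obtain ⟨i, rfl⟩ := (List.mem_ofFn' _ _).1 hl
    exact hv i
  refine Finsupp.ext <| congrFun <| List.ofFn_inj.mp ?_
  apply Nat.ofDigits_inj_of_len_eq hB (by simp) (hlt hv) (hlt hw)
  simpa only [shearWeight, Nat.ofDigits_eq_sum_mapIdx, List.mapIdx_eq_ofFn, List.get_ofFn,
    List.length_ofFn, Fin.val_cast, mul_comm, List.sum_ofFn] using! h

lemma shear_monomial_monic {B : ℕ} (hB : 0 < B) (γ : Fin (m + 1) →₀ ℕ) :
    (MvPolynomial.finSuccEquiv F m (shear F m B (MvPolynomial.monomial γ 1))).Monic ∧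
    (MvPolynomial.finSuccEquiv F m (shear F m B (MvPolynomial.monomial γ 1))).natDegree =
      shearWeight B γ := by
  have hX (i : Fin (m + 1)) :
      (MvPolynomial.finSuccEquiv F m (shear F m B (MvPolynomial.X i))).Monic ∧
      (MvPolynomial.finSuccEquiv F m (shear F m B (MvPolynomial.X i))).natDegree =
        B ^ (i : ℕ) := by
    cases i using Fin.cases with
    | zero => simp [shear, shearHom, MvPolynomial.finSuccEquiv_X_zero, monic_X]
    | succ i =>
      have h : MvPolynomial.finSuccEquiv F m (shear F m B (MvPolynomial.X i.succ)) =
          X ^ B ^ (i.succ : ℕ) + C (MvPolynomial.X i) := by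
        simp [shear, shearHom, MvPolynomial.finSuccEquiv_X_zero,
          MvPolynomial.finSuccEquiv_X_succ, add_comm]
      rw [h]
      exact ⟨monic_X_pow_add_C _ (pow_pos hB _).ne', natDegree_X_pow_add_C⟩
  rw [MvPolynomial.monomial_eq, Finsupp.prod_fintype _ _ (fun i => pow_zero _)]
  simp only [map_one, one_mul, map_prod, map_pow]
  refine ⟨monic_prod_of_monic _ _ fun i _ => (hX i).1.pow _, ?_⟩
  rw [natDegree_prod_of_monic _ _ fun i _ => (hX i).1.pow _]
  exact Finset.sum_congr rfl fun i _ => by rw [(hX i).1.natDegree_pow, (hX i).2, mul_comm]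

/-- For large `B`, the polynomial obtained from `p` by the shear has, as a polynomial in `X 0`, a
leading coefficient that is one of the coefficients of `p`. -/
lemma exists_shear_leadingCoeff {p : MvPolynomial (Fin (m + 1)) F} (hp : p ≠ 0) :
    ∃ B s, ∃ v ∈ p.support,
      (MvPolynomial.finSuccEquiv F m (shear F m B p)).coeff s = MvPolynomial.C (p.coeff v) ∧
      ∀ n, s < n → (MvPolynomial.finSuccEquiv F m (shear F m B p)).coeff n = 0 := by
  set B := 2 + p.totalDegree with hB
  have hlt : ∀ γ ∈ p.support, ∀ i, γ i < B := fun γ hγ i => by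
    have := (MvPolynomial.monomial_le_degreeOf i hγ).trans
      (MvPolynomial.degreeOf_le_totalDegree p i)
    omega
  obtain ⟨v, hv, hmax⟩ := Finset.exists_max_image p.support (shearWeight B)
    (MvPolynomial.support_nonempty.2 hp)
  have hcoeff (n) : (MvPolynomial.finSuccEquiv F m (shear F m B p)).coeff n =
      ∑ γ ∈ p.support, MvPolynomial.C (p.coeff γ) *
        (MvPolynomial.finSuccEquiv F m (shear F m B (MvPolynomial.monomial γ 1))).coeff n := by
    conv_lhs => rw [p.as_sum]
    rw [map_sum, map_sum, finsetSum_coeff]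
    refine Finset.sum_congr rfl fun γ _ => ?_
    rw [← mul_one (p.coeff γ), ← MvPolynomial.C_mul_monomial, map_mul, map_mul,
      ← MvPolynomial.algebraMap_eq, AlgEquiv.commutes, MvPolynomial.algebraMap_eq,
      MvPolynomial.finSuccEquiv_apply, MvPolynomial.eval₂Hom_C]
    simp [coeff_C_mul]
  refine ⟨B, shearWeight B v, v, hv, ?_, fun n hn => ?_⟩
  · rw [hcoeff, Finset.sum_eq_single_of_mem v hv]
    · have h := shear_monomial_monic (F := F) (B := B) (by omega) v
      rw [← h.2, h.1.coeff_natDegree, mul_one]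
    · intro γ hγ hne
      have h := shear_monomial_monic (F := F) (B := B) (by omega) γ
      rw [coeff_eq_zero_of_natDegree_lt, mul_zero]
      rw [h.2]
      exact (hmax γ hγ).lt_of_ne fun he =>
        hne (shearWeight_injOn (by omega) (hlt γ hγ) (hlt v hv) he)
  · rw [hcoeff]
    refine Finset.sum_eq_zero fun γ hγ => ?_
    rw [coeff_eq_zero_of_natDegree_lt, mul_zero]
    rw [(shear_monomial_monic (F := F) (B := B) (by omega) γ).2]
    exact (hmax γ hγ).trans_lt hn

end Shear

section Iterate

open Polynomial

variable {F : Type*} [NormedField F] [IsUltrametricDist F] {m : ℕ}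

lemma norm_ofMvPolynomial_le {σ : Type*} {p : MvPolynomial σ F} {C : ℝ}
    (h : ∀ γ, ‖p.coeff γ‖ ≤ C) : ‖ofMvPolynomial p‖ ≤ C :=
  norm_le fun γ => by rw [coeff_ofMvPolynomial]; exact h γ

lemma norm_ofMvPolynomial_C {σ : Type*} (a : F) :
    ‖(ofMvPolynomial (MvPolynomial.C a) : tateAlgebra σ F)‖ = ‖a‖ := by
  classical
  refine le_antisymm (norm_ofMvPolynomial_le fun γ => ?_) ?_
  · rw [MvPolynomial.coeff_C]; split_ifs <;> simp
  · simpa [coeff_ofMvPolynomial] using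
      norm_coeff_le (ofMvPolynomial (MvPolynomial.C a) : tateAlgebra σ F) 0

lemma norm_ofMvPolynomial_X_le {σ : Type*} (i : σ) :
    ‖(ofMvPolynomial (MvPolynomial.X i) : tateAlgebra σ F)‖ ≤ 1 := by
  classical
  refine norm_ofMvPolynomial_le fun γ => ?_
  rw [MvPolynomial.coeff_X]; split_ifs <;> simp

lemma norm_ofMvPolynomial_aeval_le {σ : Type*} [Finite σ] {x : σ → MvPolynomial σ F}
    (hx : ∀ i, ‖ofMvPolynomial (x i)‖ ≤ 1) (p : MvPolynomial σ F) :
    ‖ofMvPolynomial (MvPolynomial.aeval x p)‖ ≤ ‖ofMvPolynomial p‖ := by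
  cases nonempty_fintype σ
  rw [MvPolynomial.aeval_def, MvPolynomial.eval₂_eq', map_sum]
  refine IsUltrametricDist.norm_sum_le_of_forall_le_of_nonneg (norm_nonneg _) fun γ _ => ?_
  rw [map_mul, MvPolynomial.algebraMap_eq, norm_mul, norm_ofMvPolynomial_C, map_prod, norm_prod]
  refine (mul_le_of_le_one_right (norm_nonneg _) ?_).trans ?_
  rotate_left
  · simpa [coeff_ofMvPolynomial] using norm_coeff_le (ofMvPolynomial p) γ
  · refine Finset.prod_le_one (fun _ _ => norm_nonneg _) fun i _ => ?_
    rw [map_pow, norm_pow]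
    exact pow_le_one₀ (norm_nonneg _) (hx i)

lemma norm_shearHom_le (B : ℕ) {c : F} (hc : ‖c‖ ≤ 1) (p : MvPolynomial (Fin (m + 1)) F) :
    ‖ofMvPolynomial (shearHom m B c p)‖ ≤ ‖ofMvPolynomial p‖ := by
  refine norm_ofMvPolynomial_aeval_le (fun i => ?_) p
  split_ifs
  · exact norm_ofMvPolynomial_X_le 0
  · rw [map_add, MvPolynomial.smul_eq_C_mul, map_mul, map_pow]
    refine (norm_add_le_max _ _).trans (max_le (norm_ofMvPolynomial_X_le _) ?_)
    rw [norm_mul, norm_pow, norm_ofMvPolynomial_C]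
    exact mul_le_one₀ hc (by positivity)
      (pow_le_one₀ (norm_nonneg _) (norm_ofMvPolynomial_X_le _))

/-- The shear preserves the Gauss norm, since it and its inverse do not increase it. -/
lemma norm_shear (B : ℕ) (p : MvPolynomial (Fin (m + 1)) F) :
    ‖ofMvPolynomial (shear F m B p)‖ = ‖ofMvPolynomial p‖ := by
  refine le_antisymm (norm_shearHom_le B (by simp) p) ?_
  have h := norm_shearHom_le B (c := (-1 : F)) (by simp) (shear F m B p)
  rwa [show shearHom m B (-1 : F) (shear F m B p) = p from (shear F m B).symm_apply_apply p] at h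

/-- Polynomials in `m + 1` variables inside the Tate algebra in one variable over the Tate algebra
in `m` variables. -/
noncomputable def ofMvPolynomialSucc :
    MvPolynomial (Fin (m + 1)) F →+* tateAlgebra Unit (tateAlgebra (Fin m) F) :=
  (ofPolynomial.comp (Polynomial.mapRingHom ofMvPolynomial)).comp
    (MvPolynomial.finSuccEquiv F m).toRingEquiv.toRingHom

lemma coeffNat_ofMvPolynomialSucc (n : ℕ) (p : MvPolynomial (Fin (m + 1)) F) :
    coeffNat n (ofMvPolynomialSucc p) =
      ofMvPolynomial ((MvPolynomial.finSuccEquiv F m p).coeff n) := by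
  change coeffNat n (ofPolynomial (Polynomial.map ofMvPolynomial _)) = _
  rw [coeffNat_ofPolynomial, Polynomial.coeff_map]
  rfl

lemma norm_ofMvPolynomialSucc (p : MvPolynomial (Fin (m + 1)) F) :
    ‖ofMvPolynomialSucc p‖ = ‖ofMvPolynomial p‖ := by
  have h (n : ℕ) (γ : Fin m →₀ ℕ) :
      coeff γ (coeffNat n (ofMvPolynomialSucc p)) = coeff (γ.cons n) (ofMvPolynomial p) := by
    rw [coeffNat_ofMvPolynomialSucc, coeff_ofMvPolynomial, coeff_ofMvPolynomial,
      MvPolynomial.finSuccEquiv_coeff_coeff]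
  refine le_antisymm (norm_le_of_coeffNat fun n => norm_le fun γ => h n γ ▸ norm_coeff_le _ _)
    (norm_le fun δ => ?_)
  rw [← Finsupp.cons_tail δ, ← h]
  exact (norm_coeff_le _ _).trans (norm_coeffNat_le _ _)

lemma denseRange_ofMvPolynomialSucc :
    DenseRange (ofMvPolynomialSucc : MvPolynomial (Fin (m + 1)) F → _) := by
  set S : Subring (tateAlgebra Unit (tateAlgebra (Fin m) F)) :=
    (ofMvPolynomialSucc (F := F) (m := m)).range.topologicalClosure with hS
  have hclosed : IsClosed (S : Set (tateAlgebra Unit (tateAlgebra (Fin m) F))) :=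
    Subring.isClosed_topologicalClosure _
  have hsub (p) : ofMvPolynomialSucc p ∈ S := Subring.le_topologicalClosure _ ⟨p, rfl⟩
  have hpoly (p : (MvPolynomial (Fin m) F)[X]) : ofPolynomial (p.map ofMvPolynomial) ∈ S := by
    obtain ⟨q, rfl⟩ := (MvPolynomial.finSuccEquiv F m).surjective p
    exact hsub q
  have hX : ofPolynomial X ∈ S := by simpa using hpoly X
  have hC (a : tateAlgebra (Fin m) F) : ofPolynomial (C a) ∈ S := by
    have hcont : Continuous fun a : tateAlgebra (Fin m) F => ofPolynomial (C a) :=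
      AddMonoidHomClass.continuous_of_bound
        ((ofPolynomial.comp C : tateAlgebra (Fin m) F →+* _)) 1 fun a =>
          norm_ofPolynomial_le fun n => by
            rw [one_mul, coeff_C]; split_ifs <;> simp
    refine denseRange_ofMvPolynomial.induction_on a (hclosed.preimage hcont) fun q => ?_
    simpa using hpoly (C q)
  have hall (p : (tateAlgebra (Fin m) F)[X]) : ofPolynomial p ∈ S := by
    induction p using Polynomial.induction_on' with
    | add p q hp hq => rw [map_add]; exact add_mem hp hq
    | monomial n a =>
      rw [← C_mul_X_pow_eq_monomial, map_mul, map_pow]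
      exact mul_mem (hC a) (pow_mem hX n)
  have htop : ∀ x, x ∈ S := fun x =>
    denseRange_ofPolynomial.induction_on x hclosed hall
  intro x
  exact htop x

end Iterate

end tateAlgebra

/-! ### Factoriality of the Tate algebra -/

namespace tateAlgebra

section Factorial

/-- A unit of norm one of a complete ultrametric ring stays one after a perturbation of norm less
than one. -/
lemma isUnit_of_norm_sub_lt {A : Type*} [NormedCommRing A] [NormMulClass A]
    [NormOneClass A] [CompleteSpace A] {a b : A} (ha : IsUnit a) (ha1 : ‖a‖ = 1)
    (h : ‖b - a‖ < 1) : IsUnit b := by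
  obtain ⟨u, rfl⟩ := ha
  have hinv : ‖(↑u⁻¹ : A)‖ = 1 := by
    have := congrArg norm u.inv_mul
    rwa [norm_mul, ha1, mul_one, norm_one] at this
  have : b = u * (1 - ↑u⁻¹ * (u - b)) := by rw [mul_sub, ← mul_assoc, u.mul_inv]; ring
  rw [this]
  refine u.isUnit.mul (isUnit_one_sub_of_norm_lt_one ?_)
  rwa [norm_mul, hinv, one_mul, norm_sub_rev]

lemma norm_eq_of_norm_sub_lt {A : Type*} [NormedCommRing A] [IsUltrametricDist A] {a b : A}
    (ha1 : ‖a‖ = 1) (h : ‖b - a‖ < 1) : ‖b‖ = 1 := by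
  have := IsUltrametricDist.norm_add_eq_max_of_norm_ne_norm (x := a) (y := b - a)
    (by rw [ha1]; exact h.ne')
  rwa [add_sub_cancel, ha1, max_eq_left h.le] at this

/-- The elements that are products of units and primes are preserved by ring isomorphisms. -/
lemma mem_closure_of_ringEquiv {R S : Type*} [CommRing R] [CommRing S] (e : R ≃+* S) {x : R}
    (hx : e x ∈ Submonoid.closure {y : S | IsUnit y ∨ Prime y}) :
    x ∈ Submonoid.closure {y : R | IsUnit y ∨ Prime y} := by
  have hle : Submonoid.closure {y : S | IsUnit y ∨ Prime y} ≤
      (Submonoid.closure {y : R | IsUnit y ∨ Prime y}).comap (e.symm : S →* R) := by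
    refine Submonoid.closure_le.2 fun y hy => Submonoid.subset_closure ?_
    exact hy.imp (fun h => h.map e.symm) fun h => (MulEquiv.prime_iff e.symm.toMulEquiv).2 h
  simpa using hle hx

variable {F : Type*} [NormedField F] [IsUltrametricDist F] [CompleteSpace F]

/-- The shear extends to an isometric isomorphism from the Tate algebra in `m + 1` variables to the
Tate algebra in one variable over the Tate algebra in `m` variables. -/
lemma exists_ringEquiv_shear {m : ℕ} (B : ℕ) :
    ∃ e : tateAlgebra (Fin (m + 1)) F ≃+* tateAlgebra Unit (tateAlgebra (Fin m) F),
      (∀ p, e (ofMvPolynomial p) = ofMvPolynomialSucc (shear F m B p)) ∧ ∀ x, ‖e x‖ = ‖x‖ := by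
  refine exists_ringEquiv_of_denseRange ofMvPolynomial
    (ofMvPolynomialSucc.comp (shear F m B).toRingEquiv.toRingHom) denseRange_ofMvPolynomial ?_ ?_
  · have h : Set.range (ofMvPolynomialSucc.comp (shear F m B).toRingEquiv.toRingHom) =
        Set.range (ofMvPolynomialSucc (F := F) (m := m)) :=
      (shear F m B).surjective.range_comp ofMvPolynomialSucc
    rw [DenseRange, h]
    exact denseRange_ofMvPolynomialSucc
  · intro p
    change _ = ‖ofMvPolynomialSucc (shear F m B p)‖
    rw [norm_ofMvPolynomialSucc, norm_shear]

/-- An element of Gauss norm one becomes distinguished after a shear. -/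
lemma exists_ringEquiv_isDistinguished {m : ℕ} {f : tateAlgebra (Fin (m + 1)) F}
    (hf : ‖f‖ = 1) :
    ∃ (e : tateAlgebra (Fin (m + 1)) F ≃+* tateAlgebra Unit (tateAlgebra (Fin m) F)) (s : ℕ),
      IsDistinguished s (e f) := by
  obtain ⟨p, hp, hpc⟩ := exists_norm_sub_ofMvPolynomial_lt f one_pos
  have hp0 : p ≠ 0 := by
    rintro rfl
    simp [hf] at hp
  obtain ⟨B, s, v, hv, hs, hlt⟩ := exists_shear_leadingCoeff hp0
  have hnv : ‖p.coeff v‖ = 1 := by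
    obtain ⟨h1, h2⟩ := hpc v hv
    rw [h1]
    exact le_antisymm (hf ▸ norm_coeff_le f v) h2
  obtain ⟨e, he, hen⟩ := exists_ringEquiv_shear (F := F) (m := m) B
  have hsub (n : ℕ) : ‖coeffNat n (e f) -
      ofMvPolynomial ((MvPolynomial.finSuccEquiv F m (shear F m B p)).coeff n)‖ < 1 := by
    rw [← coeffNat_ofMvPolynomialSucc, ← map_sub]
    refine (norm_coeffNat_le _ n).trans_lt ?_
    have h : ofMvPolynomialSucc (shear F m B p) = e (ofMvPolynomial p) := (he p).symm
    rwa [h, ← map_sub, hen]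
  have hunit : IsUnit (ofMvPolynomial (MvPolynomial.C (p.coeff v)) : tateAlgebra (Fin m) F) :=
    ((isUnit_iff_ne_zero.2 (norm_ne_zero_iff.1 (by rw [hnv]; exact one_ne_zero))).map
      MvPolynomial.C).map ofMvPolynomial
  have hone : ‖(ofMvPolynomial (MvPolynomial.C (p.coeff v)) : tateAlgebra (Fin m) F)‖ = 1 := by
    rw [norm_ofMvPolynomial_C, hnv]
  have hss := hs ▸ hsub s
  refine ⟨e, s, isUnit_of_norm_sub_lt hunit hone hss, norm_eq_of_norm_sub_lt hone hss,
    (hen f).trans hf |>.le, fun n hn => ?_⟩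
  simpa [hlt n hn] using hsub n

/-- **The Tate algebra is factorial.** -/
instance (m : ℕ) : UniqueFactorizationMonoid (tateAlgebra (Fin m) F) := by
  induction m with
  | zero =>
    refine UniqueFactorizationMonoid.of_exists_prime_factors fun f hf => ⟨0, by simp, ?_⟩
    have hfC : f = ofMvPolynomial (MvPolynomial.C (coeff 0 f)) := ext fun γ => by
      rw [Subsingleton.elim γ 0, coeff_ofMvPolynomial, MvPolynomial.coeff_zero_C]
    have h0 : coeff 0 f ≠ 0 := fun h => hf (by rw [hfC, h, map_zero, map_zero])
    rw [Multiset.prod_zero, hfC]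
    exact (associated_one_iff_isUnit.2
      (((isUnit_iff_ne_zero.2 h0).map MvPolynomial.C).map ofMvPolynomial)).symm
  | succ m ih =>
    have hmem (f : tateAlgebra (Fin (m + 1)) F) (hf : f ≠ 0) :
        f ∈ Submonoid.closure {x : tateAlgebra (Fin (m + 1)) F | IsUnit x ∨ Prime x} := by
      obtain ⟨γ, hγ⟩ := exists_norm_coeff_eq f
      have h0 : coeff γ f ≠ 0 := norm_ne_zero_iff.1 (hγ ▸ norm_ne_zero_iff.2 hf)
      obtain ⟨e, s, hs⟩ := exists_ringEquiv_isDistinguished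
        (f := ofMvPolynomial (MvPolynomial.C (coeff γ f)⁻¹) * f) (by
          rw [norm_mul, norm_ofMvPolynomial_C, ← hγ, norm_inv,
            inv_mul_cancel₀ (norm_ne_zero_iff.2 h0)])
      have h := mem_closure_of_ringEquiv e hs.mem_closure
      rw [mul_comm] at h
      exact divisor_closure_eq_closure _ _ h
    refine UniqueFactorizationMonoid.of_exists_prime_factors fun f hf => ?_
    induction hmem f hf using Submonoid.closure_induction with
    | mem x hx =>
      rcases hx with hx | hx
      · exact ⟨0, by simp, by simpa using (associated_one_iff_isUnit.2 hx).symm⟩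
      · exact ⟨{x}, by simpa using hx, by simp⟩
    | one => exact ⟨0, by simp, by simp⟩
    | mul x y _ _ hx hy =>
      obtain ⟨s, hs, hs'⟩ := hx (left_ne_zero_of_mul hf)
      obtain ⟨t, ht, ht'⟩ := hy (right_ne_zero_of_mul hf)
      refine ⟨s + t, fun b hb => ?_, by rw [Multiset.prod_add]; exact hs'.mul_mul ht'⟩
      exact (Multiset.mem_add.1 hb).elim (hs b) (ht b)

end Factorial

end tateAlgebra

/-! ### Square-free parts by approximation -/

section FactorialApproximation

variable {R T : Type*} [CommRing R] [CommRing T]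

/-- A descending chain of divisors in a factorial domain is eventually constant up to units. -/
lemma exists_forall_associated_of_dvd_of_succ_dvd [IsDomain T] [UniqueFactorizationMonoid T]
    {x : ℕ → T} (h : ∀ k, x (k + 1) ∣ x k) :
    ∃ K, ∀ k, K ≤ k → Associated (x k) (x K) := by
  have : WellFoundedLT (Associates T) := WfDvdMonoid.wellFoundedLT_associates
  have hanti : Antitone fun k => Associates.mk (x k) :=
    antitone_nat_of_succ_le fun k => Associates.mk_le_mk_iff_dvd.2 (h k)
  obtain ⟨K, hK⟩ := WellFoundedLT.antitone_chain_condition hanti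
  exact ⟨K, fun k hk => (Associates.mk_eq_mk_iff_associated.1 (hK k hk)).symm⟩

/-- An ascending chain of divisors of a nonzero element of a factorial domain is eventually
constant up to units. -/
lemma exists_forall_associated_of_dvd_succ [IsDomain T] [UniqueFactorizationMonoid T]
    {x : ℕ → T} {b : T} (hb : b ≠ 0) (h : ∀ k, x k ∣ x (k + 1)) (hxb : ∀ k, x k ∣ b) :
    ∃ K, ∀ k, K ≤ k → Associated (x k) (x K) := by
  choose y hy using hxb
  have hx0 (k) : x k ≠ 0 := fun h0 => hb (by rw [hy k, h0, zero_mul])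
  obtain ⟨K, hK⟩ := exists_forall_associated_of_dvd_of_succ_dvd (x := y) fun k => by
    obtain ⟨z, hz⟩ := h k
    refine ⟨z, mul_left_cancel₀ (hx0 k) ?_⟩
    rw [← hy k, hy (k + 1), hz]
    ring
  refine ⟨K, fun k hk => ?_⟩
  have hy0 : y k ≠ 0 := fun h0 => hb (by rw [hy k, h0, mul_zero])
  exact Associated.of_mul_right (.of_eq ((hy k).symm.trans (hy K))) (hK k hk) hy0

/-- A ring `R` approximated by a decreasing sequence of copies of a ring `T`, as the ring of entire
functions is by the rings of functions on closed polydiscs of increasing radii. The map `ι n` is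
the restriction to the polydisc of index `n`, and `ρ` the restriction from each polydisc to the
preceding one. Divisibility can be tested on all polydiscs, and divisors can be glued. -/
structure IsApproximation (ι : ℕ → R →+* T) (ρ : T →+* T) : Prop where
  injective : ∀ n, Function.Injective (ι n)
  restrict_injective : Function.Injective ρ
  restrict : ∀ n x, ρ (ι (n + 1) x) = ι n x
  dvd_of_forall_dvd : ∀ a b, (∀ n, ι n a ∣ ι n b) → a ∣ b
  glue : ∀ h : ℕ → T, (∀ n, h n ≠ 0) → (∀ n, Associated (ρ (h (n + 1))) (h n)) →
    ∃ S, ∀ n, Associated (ι n S) (h n)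

namespace IsApproximation

variable {ι : ℕ → R →+* T} {ρ : T →+* T}

lemma restrict_pow (H : IsApproximation ι ρ) (n k : ℕ) (x : R) :
    (ρ ^ k) (ι (n + k) x) = ι n x := by
  induction k with
  | zero => rfl
  | succ k ih =>
    rw [pow_succ, RingHom.mul_def, RingHom.comp_apply, ← add_assoc, H.restrict, ih]

lemma restrict_pow_injective (H : IsApproximation ι ρ) (k : ℕ) :
    Function.Injective (ρ ^ k : T →+* T) := by
  rw [RingHom.coe_pow]
  exact H.restrict_injective.iterate k

lemma isUnit_of_forall (H : IsApproximation ι ρ) {a : R} (h : ∀ n, IsUnit (ι n a)) : IsUnit a :=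
  isUnit_of_dvd_one (H.dvd_of_forall_dvd a 1 fun n => (h n).dvd)

/-- If the restrictions of `t (n + k)` to the polydisc of index `n` are eventually constant up to
units as `k` grows, then these eventual values are glued by an element of `R`. -/
lemma exists_eventually_associated (H : IsApproximation ι ρ) {t : ℕ → T} (ht : ∀ n, t n ≠ 0)
    (hst : ∀ n, ∃ K, ∀ k, K ≤ k → Associated ((ρ ^ k) (t (n + k))) ((ρ ^ K) (t (n + K)))) :
    ∃ S, ∀ n, ∃ K, ∀ k, K ≤ k → Associated (ι n S) ((ρ ^ k) (t (n + k))) := by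
  choose K hK using hst
  obtain ⟨S, hS⟩ := H.glue (fun n => (ρ ^ K n) (t (n + K n)))
    (fun n => (map_ne_zero_iff _ (H.restrict_pow_injective _)).2 (ht _)) fun n => by
      set k := max (K n) (K (n + 1)) with hk
      have h1 := (hK (n + 1) k (le_max_right _ _)).map ρ
      have h2 := hK n (k + 1) ((le_max_left _ _).trans (Nat.le_succ _))
      refine h1.symm.trans (Associated.trans ?_ h2)
      rw [pow_succ', RingHom.mul_def, RingHom.comp_apply,
        show n + 1 + k = n + (k + 1) by ring]
  exact ⟨S, fun n => ⟨K n, fun k hk => (hS n).trans (hK n k hk).symm⟩⟩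

variable [IsDomain T] [UniqueFactorizationMonoid T]

/-- The square-free part is glued from the square-free parts on the polydiscs. Square-freeness on
a polydisc need not be known to persist on smaller ones: if `S = g * g * h`, then each local
square-free part divides `g * h`, so `S` divides `g * h` on every polydisc and `g` is a unit. An
irreducible `P` dividing `f` divides `S`: the local greatest common divisors of `P` and `S` glue to
a divisor of `P`, and were this a unit, `P` would be a unit on every polydisc. -/
theorem exists_squarefree_part (H : IsApproximation ι ρ) {f : R} (hf : f ≠ 0) :
    ∃ S : R, Squarefree S ∧ ∀ P : R, Irreducible P → (P ∣ S ↔ P ∣ f) := by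
  have hinj (n : ℕ) {x : R} : ι n x ≠ 0 ↔ x ≠ 0 := map_ne_zero_iff _ (H.injective n)
  choose t e htsq htf hft using
    fun n => exists_squarefree_dvd_pow_of_ne_zero ((hinj n).2 hf)
  have ht0 (n) : t n ≠ 0 := (htsq n).ne_zero
  have hdvd (n) : t n ∣ ρ (t (n + 1)) :=
    (htsq n).isRadical (e (n + 1)) _ ((htf n).trans (by
      rw [← map_pow, ← H.restrict n f]; exact map_dvd ρ (hft (n + 1))))
  have hdvd' (n k) : (ρ ^ k) (t (n + k)) ∣ (ρ ^ (k + 1)) (t (n + (k + 1))) := by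
    rw [pow_succ, RingHom.mul_def, RingHom.comp_apply]
    exact map_dvd _ (hdvd (n + k))
  have hdvd0 (n k) : t n ∣ (ρ ^ k) (t (n + k)) := by
    induction k with
    | zero => exact dvd_rfl
    | succ k ih => exact ih.trans (hdvd' n k)
  have hle (n k) : (ρ ^ k) (t (n + k)) ∣ ι n f := by
    rw [← H.restrict_pow n k f]
    exact map_dvd _ (htf _)
  obtain ⟨S, hS⟩ := H.exists_eventually_associated ht0 fun n =>
    exists_forall_associated_of_dvd_succ ((hinj n).2 hf) (hdvd' n) (hle n)
  have hSf : S ∣ f := H.dvd_of_forall_dvd _ _ fun n => by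
    obtain ⟨K, hK⟩ := hS n
    exact (hK K le_rfl).dvd.trans (hle n K)
  have hS0 : S ≠ 0 := fun h => hf (zero_dvd_iff.1 (h ▸ hSf))
  -- locally, `f` divides a power of `S`
  have hfS (n) : ∃ k, ι n f ∣ ι n S ^ k := by
    obtain ⟨K, hK⟩ := hS n
    exact ⟨e n, (hft n).trans (pow_dvd_pow_of_dvd ((hdvd0 n K).trans (hK K le_rfl).dvd') _)⟩
  refine ⟨S, ?_, fun P hP => ⟨fun h => h.trans hSf, fun hPf => ?_⟩⟩
  · rintro g ⟨h, hgh⟩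
    have hgh0 : g * h ≠ 0 := fun h0 => hS0 (by rw [hgh, mul_assoc, h0, mul_zero])
    refine H.isUnit_of_forall fun n => ?_
    obtain ⟨K, hK⟩ := hS n
    have h1 : t (n + K) ∣ ι (n + K) (g * h) := by
      obtain ⟨k, hk⟩ := hfS (n + K)
      refine (htsq (n + K)).isRadical (2 * k) _ ((htf _).trans (hk.trans ?_))
      rw [pow_mul, ← map_pow (ι (n + K)) (g * h)]
      have hS2 : S ∣ (g * h) ^ 2 := ⟨h, by rw [hgh]; ring⟩
      exact pow_dvd_pow_of_dvd (map_dvd (ι (n + K)) hS2) _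
    have h2 : ι n S ∣ ι n (g * h) := by
      rw [← H.restrict_pow n K (g * h)]
      exact (hK K le_rfl).dvd.trans (map_dvd _ h1)
    rw [hgh, mul_assoc, map_mul] at h2
    refine isUnit_of_dvd_one ((mul_dvd_mul_iff_right ((hinj n).2 hgh0)).1 ?_)
    rwa [one_mul]
  · let : GCDMonoid T := UniqueFactorizationMonoid.toGCDMonoid T
    set G : ℕ → T := fun n => gcd (ι n P) (ι n S) with hG
    have hG0 (n) : G n ≠ 0 := fun h => (hinj n).2 hS0 ((gcd_eq_zero_iff _ _).1 h).2
    have hGdvd (n k) : (ρ ^ (k + 1)) (G (n + (k + 1))) ∣ (ρ ^ k) (G (n + k)) := by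
      rw [pow_succ, RingHom.mul_def, RingHom.comp_apply]
      refine map_dvd _ (dvd_gcd ?_ ?_)
      · rw [← H.restrict (n + k) P]; exact map_dvd ρ (gcd_dvd_left _ _)
      · rw [← H.restrict (n + k) S]; exact map_dvd ρ (gcd_dvd_right _ _)
    obtain ⟨D, hD⟩ := H.exists_eventually_associated hG0 fun n =>
      exists_forall_associated_of_dvd_of_succ_dvd (hGdvd n)
    have hDP : D ∣ P := H.dvd_of_forall_dvd _ _ fun n => by
      obtain ⟨K, hK⟩ := hD n
      rw [← H.restrict_pow n K P]
      exact (hK K le_rfl).dvd.trans (map_dvd _ (gcd_dvd_left _ _))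
    have hDS : D ∣ S := H.dvd_of_forall_dvd _ _ fun n => by
      obtain ⟨K, hK⟩ := hD n
      rw [← H.restrict_pow n K S]
      exact (hK K le_rfl).dvd.trans (map_dvd _ (gcd_dvd_right _ _))
    obtain ⟨c, hc⟩ := hDP
    rcases hP.isUnit_or_isUnit hc with hu | hu
    · refine absurd (H.isUnit_of_forall fun n => ?_) hP.not_isUnit
      obtain ⟨K, hK⟩ := hD n
      have hunit : IsUnit ((ρ ^ K) (G (n + K))) := (hK K le_rfl).isUnit (hu.map (ι n))
      obtain ⟨k, hk⟩ := hfS (n + K)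
      have hPG : ι (n + K) P ∣ G (n + K) ^ k :=
        (dvd_gcd dvd_rfl ((map_dvd _ hPf).trans hk)).trans gcd_pow_right_dvd_pow_gcd
      have := map_dvd (ρ ^ K) hPG
      rw [H.restrict_pow, map_pow] at this
      exact isUnit_of_dvd_unit this (hunit.pow k)
    · rw [hc]
      exact (hu.mul_right_dvd.2 dvd_rfl).trans hDS

end IsApproximation

end FactorialApproximation

/-! ### Entire functions as limits of Tate algebras -/

namespace tateAlgebra

section Rescale

lemma coeff_rescale_const {σ F : Type*} [CommSemiring F] (a : F) (f : MvPowerSeries σ F)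
    (γ : σ →₀ ℕ) :
    MvPowerSeries.coeff γ (MvPowerSeries.rescale (fun _ => a) f) =
      a ^ γ.degree * MvPowerSeries.coeff γ f := by
  rw [MvPowerSeries.coeff_rescale, Finsupp.prod, Finset.prod_pow_eq_pow_sum, Finsupp.degree]
  rfl

variable {F : Type*} [NormedField F] [IsUltrametricDist F] {m : ℕ}

lemma rescale_mem {σ : Type*} {a : F} {f : MvPowerSeries σ F}
    (h : MvPowerSeries.IsRestricted (fun _ => ‖a‖) f) :
    MvPowerSeries.rescale (fun _ => a) f ∈ tateAlgebra σ F := by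
  rw [mem_iff]
  refine h.congr fun γ => ?_
  rw [coeff_rescale_const, norm_mul, norm_pow, Finsupp.prod, Finset.prod_pow_eq_pow_sum, mul_comm]
  rfl

/-- An entire function restricted to the polydisc of radius `‖a‖`, in the coordinates in which this
is the unit polydisc: the map `f(z) ↦ f(a z)`. -/
noncomputable def ofEntire (a : F) : entireRing F m →+* tateAlgebra (Fin m) F :=
  ((MvPowerSeries.rescale fun _ => a).comp (entireRing F m).subtype).codRestrict _ fun f =>
    rescale_mem (f.2 _ fun _ => norm_nonneg a)

lemma coeff_ofEntire (a : F) (f : entireRing F m) (γ : Fin m →₀ ℕ) :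
    coeff γ (ofEntire a f) = a ^ γ.degree * MvPowerSeries.coeff γ f.1 :=
  coeff_rescale_const a f.1 γ

/-- The map `f(z) ↦ f(b z)` on the Tate algebra, for `‖b‖ ≤ 1`. -/
noncomputable def contract {b : F} (hb : ‖b‖ ≤ 1) :
    tateAlgebra (Fin m) F →+* tateAlgebra (Fin m) F :=
  ((MvPowerSeries.rescale fun _ => b).comp (tateAlgebra (Fin m) F).subtype).codRestrict _
    fun f => by
      refine mem_iff.2 (squeeze_zero (fun _ => norm_nonneg _) (fun γ => ?_)
        (tendsto_norm_coeff f))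
      rw [RingHom.comp_apply, coeff_rescale_const, norm_mul, norm_pow]
      exact mul_le_of_le_one_left (norm_nonneg _) (pow_le_one₀ (norm_nonneg _) hb)

lemma coeff_contract {b : F} (hb : ‖b‖ ≤ 1) (f : tateAlgebra (Fin m) F) (γ : Fin m →₀ ℕ) :
    coeff γ (contract hb f) = b ^ γ.degree * coeff γ f :=
  coeff_rescale_const b f.1 γ

lemma coeff_contract_pow {b : F} (hb : ‖b‖ ≤ 1) (k : ℕ) (f : tateAlgebra (Fin m) F)
    (γ : Fin m →₀ ℕ) : coeff γ ((contract hb ^ k) f) = (b ^ γ.degree) ^ k * coeff γ f := by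
  induction k with
  | zero => simp
  | succ k ih =>
    rw [pow_succ', RingHom.mul_def, RingHom.comp_apply, coeff_contract, ih, pow_succ']
    ring

lemma continuous_contract {b : F} (hb : ‖b‖ ≤ 1) :
    Continuous (contract hb : tateAlgebra (Fin m) F →+* _) :=
  AddMonoidHomClass.continuous_of_bound _ 1 fun f => norm_le fun γ => by
    rw [coeff_contract, norm_mul, norm_pow, one_mul]
    exact (mul_le_of_le_one_left (norm_nonneg _) (pow_le_one₀ (norm_nonneg _) hb)).trans
      (norm_coeff_le f γ)

/-- A unit with constant term one is close to one on small polydiscs. -/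
lemma norm_contract_pow_sub_one_le {b : F} (hb : ‖b‖ ≤ 1) {u : tateAlgebra (Fin m) F}
    (hu : IsUnit u) (hu1 : coeff 0 u = 1) (k : ℕ) : ‖(contract hb ^ k) u - 1‖ ≤ ‖b‖ ^ k := by
  refine norm_le fun γ => ?_
  rw [map_sub, coeff_contract_pow]
  rcases eq_or_ne γ 0 with rfl | hγ
  · simp [hu1, coeff_one_zero]
  · have hnorm : ‖coeff γ u‖ ≤ 1 := by
      have := norm_coeff_le u γ
      rwa [← norm_coeff_zero_of_isUnit hu, hu1, norm_one] at this
    have hdeg : 1 ≤ γ.degree :=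
      Nat.one_le_iff_ne_zero.2 fun h => hγ ((Finsupp.degree_eq_zero_iff γ).1 h)
    rw [coeff_one_of_ne hγ, sub_zero, norm_mul, norm_pow, norm_pow]
    calc (‖b‖ ^ γ.degree) ^ k * ‖coeff γ u‖ ≤ (‖b‖ ^ γ.degree) ^ k :=
        mul_le_of_le_one_right (by positivity) hnorm
      _ ≤ ‖b‖ ^ k := pow_le_pow_left₀ (by positivity)
        (pow_le_of_le_one (norm_nonneg _) hb (by omega)) k

lemma coeff_zero_mul (f g : tateAlgebra (Fin m) F) :
    coeff 0 (f * g) = coeff 0 f * coeff 0 g := by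
  simp [coeff_mul]

variable [CompleteSpace F]

/-- The multiplicative Cousin problem for units with constant term one, solved by an infinite
product. -/
lemma exists_units_eq_mul_contract {b : F} (hb : ‖b‖ < 1) (u : ℕ → (tateAlgebra (Fin m) F)ˣ)
    (hu : ∀ n, coeff 0 (u n : tateAlgebra (Fin m) F) = 1) :
    ∃ v : ℕ → tateAlgebra (Fin m) F, (∀ n, IsUnit (v n)) ∧
      ∀ n, v n = u n * contract hb.le (v (n + 1)) := by
  have hmul (u : ℕ → (tateAlgebra (Fin m) F)ˣ)
      (hu : ∀ n, coeff 0 (u n : tateAlgebra (Fin m) F) = 1) (n : ℕ) :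
      Multipliable fun k => (contract hb.le ^ k) (u (n + k) : tateAlgebra (Fin m) F) := by
    have hs : Summable fun k =>
        ‖(contract hb.le ^ k) (u (n + k) : tateAlgebra (Fin m) F) - 1‖ :=
      Summable.of_nonneg_of_le (fun _ => norm_nonneg _)
        (fun k => norm_contract_pow_sub_one_le hb.le (u (n + k)).isUnit (hu _) k)
        (summable_geometric_of_lt_one (norm_nonneg b) hb)
    simpa using multipliable_one_add_of_summable hs
  have hinv (n) : coeff 0 ((u n)⁻¹ : (tateAlgebra (Fin m) F)ˣ).1 = 1 := by
    have := coeff_zero_mul (u n).1 ((u n)⁻¹ : (tateAlgebra (Fin m) F)ˣ).1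
    rwa [Units.mul_inv, coeff_one_zero, hu, one_mul, eq_comm] at this
  refine ⟨fun n => ∏' k, (contract hb.le ^ k) (u (n + k) : tateAlgebra (Fin m) F), fun n => ?_,
    fun n => ?_⟩
  · refine IsUnit.of_mul_eq_one
      (∏' k, (contract hb.le ^ k) ((u (n + k))⁻¹ : (tateAlgebra (Fin m) F)ˣ).1) ?_
    rw [← (hmul u hu n).tprod_mul (hmul (fun n => (u n)⁻¹) hinv n)]
    simp only [← map_mul, Units.mul_inv, map_one, tprod_one]
  · have hshift (k : ℕ) : (contract hb.le ^ (k + 1)) (u (n + (k + 1))).1 =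
        contract hb.le ((contract hb.le ^ k) (u (n + 1 + k)).1) := by
      rw [pow_succ', RingHom.mul_def, RingHom.comp_apply, show n + 1 + k = n + (k + 1) by ring]
    have hm := (hmul u hu (n + 1)).map (contract hb.le) (continuous_contract hb.le)
    beta_reduce
    rw [tprod_eq_zero_mul' (f := fun k => (contract hb.le ^ k) (u (n + k)).1)
        (by simp only [hshift]; exact hm),
      (hmul u hu (n + 1)).map_tprod (contract hb.le) (continuous_contract hb.le)]
    simp only [hshift]
    rfl

end Rescale

end tateAlgebra

section Entire

open tateAlgebra

lemma norm_inv_lt_one {F : Type*} [NormedField F] {c : F} (hc : 1 < ‖c‖) : ‖c⁻¹‖ < 1 := by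
  rw [norm_inv]
  exact inv_lt_one_of_one_lt₀ hc

variable {F : Type*} [NormedField F] [IsUltrametricDist F] {m : ℕ}

/-- A power series converging on arbitrarily large polydiscs is entire. -/
lemma mem_entireRing_of_forall_pow {c : F} (hc : 1 < ‖c‖) {f : MvPowerSeries (Fin m) F}
    (h : ∀ n : ℕ, MvPowerSeries.rescale (fun _ => c ^ n) f ∈ tateAlgebra (Fin m) F) :
    f ∈ entireRing F m := by
  intro r hr
  obtain ⟨n, hn⟩ := pow_unbounded_of_one_lt (∑ i, r i) hc
  refine squeeze_zero (fun γ => mul_nonneg (norm_nonneg _)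
    (Finset.prod_nonneg fun i _ => pow_nonneg (hr i) _)) (fun γ => ?_) (mem_iff.1 (h n))
  rw [coeff_rescale_const, norm_mul, norm_pow, norm_pow, mul_comm, Finsupp.degree_apply,
    ← Finset.prod_pow_eq_pow_sum]
  refine mul_le_mul_of_nonneg_right (Finset.prod_le_prod (fun i _ => pow_nonneg (hr i) _)
    fun i _ => pow_le_pow_left₀ (hr i) ?_ _) (norm_nonneg _)
  exact (Finset.single_le_sum (fun i _ => hr i) (Finset.mem_univ i)).trans hn.le

lemma contract_ofEntire {c : F} (hc : 1 < ‖c‖) (n : ℕ) (f : entireRing F m) :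
    contract (norm_inv_lt_one hc).le (ofEntire (c ^ (n + 1)) f) = ofEntire (c ^ n) f := by
  have hc0 : c ≠ 0 := norm_pos_iff.1 (one_pos.trans hc)
  refine tateAlgebra.ext fun γ => ?_
  rw [coeff_contract, coeff_ofEntire, coeff_ofEntire, ← mul_assoc, ← mul_pow, pow_succ',
    inv_mul_cancel_left₀ hc0]

lemma ofEntire_injective {a : F} (ha : a ≠ 0) :
    Function.Injective (ofEntire a : entireRing F m →+* _) := fun f g h =>
  Subtype.ext <| MvPowerSeries.ext fun γ => by
    have := congrArg (coeff γ) h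
    rw [coeff_ofEntire, coeff_ofEntire] at this
    exact mul_left_cancel₀ (pow_ne_zero _ ha) this

/-- A compatible sequence of functions on the polydiscs comes from an entire function. -/
lemma exists_ofEntire_eq {c : F} (hc : 1 < ‖c‖) {q : ℕ → tateAlgebra (Fin m) F}
    (hq : ∀ n, contract (norm_inv_lt_one hc).le (q (n + 1)) = q n) :
    ∃ f : entireRing F m, ∀ n, ofEntire (c ^ n) f = q n := by
  have hc0 : c ≠ 0 := norm_pos_iff.1 (one_pos.trans hc)
  have hcoeff (n : ℕ) (γ : Fin m →₀ ℕ) : coeff γ (q n) = (c ^ n) ^ γ.degree * coeff γ (q 0) := by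
    induction n with
    | zero => simp
    | succ n ih =>
      rw [← hq n, coeff_contract, inv_pow, inv_mul_eq_iff_eq_mul₀ (pow_ne_zero _ hc0)] at ih
      rw [ih, ← mul_assoc, ← mul_pow, pow_succ']
  have hres (n : ℕ) : MvPowerSeries.rescale (fun _ => c ^ n) (q 0).1 = (q n).1 :=
    MvPowerSeries.ext fun γ => by
      rw [coeff_rescale_const]
      exact (hcoeff n γ).symm
  refine ⟨⟨(q 0).1, mem_entireRing_of_forall_pow hc fun n => hres n ▸ (q n).2⟩,
    fun n => Subtype.ext (hres n)⟩

variable [CompleteSpace F]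

/-- Over a nontrivially normed field, the ring of entire functions is approximated by the Tate
algebras of closed polydiscs. -/
lemma isApproximation_ofEntire {c : F} (hc : 1 < ‖c‖) :
    IsApproximation (fun n => (ofEntire (c ^ n) : entireRing F m →+* _))
      (contract (norm_inv_lt_one hc).le) := by
  have hc0 : c ≠ 0 := norm_pos_iff.1 (one_pos.trans hc)
  have hb := norm_inv_lt_one hc
  have hres : Function.Injective (contract hb.le : tateAlgebra (Fin m) F →+* _) := fun f g h =>
    tateAlgebra.ext fun γ => by
      have := congrArg (coeff γ) h
      rw [coeff_contract, coeff_contract] at this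
      exact mul_left_cancel₀ (pow_ne_zero _ (inv_ne_zero hc0)) this
  refine ⟨fun n => ofEntire_injective (pow_ne_zero n hc0), hres, contract_ofEntire hc,
    fun a b hab => ?_, fun h h0 hass => ?_⟩
  · choose q hq using hab
    rcases eq_or_ne a 0 with rfl | ha
    · rw [show b = 0 from ofEntire_injective (pow_ne_zero 0 hc0) (by
        rw [hq 0, map_zero, zero_mul])]
    obtain ⟨x, hx⟩ := exists_ofEntire_eq hc (q := q) fun n => by
      refine mul_left_cancel₀ ((map_ne_zero_iff _
        (ofEntire_injective (pow_ne_zero n hc0))).2 ha) ?_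
      rw [← hq n, ← contract_ofEntire hc n b, hq (n + 1), map_mul, contract_ofEntire hc n a]
    exact ⟨x, ofEntire_injective (pow_ne_zero 0 hc0) (by rw [hq 0, map_mul, hx 0])⟩
  · choose w hw using hass
    -- scale the transition units, and accordingly the `h n`, so as to have constant term one
    have hw0 (n) : coeff 0 (w n).1 ≠ 0 := by
      rw [← norm_ne_zero_iff, norm_coeff_zero_of_isUnit (w n).isUnit, norm_ne_zero_iff]
      exact (w n).ne_zero
    let κ : Fˣ →* (tateAlgebra (Fin m) F)ˣ :=
      Units.map ((ofMvPolynomial.comp MvPolynomial.C : F →+* tateAlgebra (Fin m) F) : F →* _)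
    have hκ (a : Fˣ) : (κ a).1 = ofMvPolynomial (MvPolynomial.C a.1) := rfl
    have hκρ (a : Fˣ) : contract hb.le (κ a).1 = (κ a).1 := by
      refine tateAlgebra.ext fun γ => ?_
      rw [coeff_contract, hκ, coeff_ofMvPolynomial, MvPolynomial.coeff_C]
      split_ifs with h
      · simp [← h]
      · simp
    let a : ℕ → Fˣ := fun n => Units.mk0 _ (hw0 n)
    have hu1 (n) : coeff 0 (κ (a n)⁻¹ * w n : (tateAlgebra (Fin m) F)ˣ).1 = 1 := by
      rw [Units.val_mul, coeff_zero_mul, hκ, coeff_ofMvPolynomial, MvPolynomial.coeff_zero_C]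
      exact inv_mul_cancel₀ (hw0 n)
    obtain ⟨v, hv, hvu⟩ := exists_units_eq_mul_contract hb (fun n => κ (a n)⁻¹ * w n) hu1
    let A : ℕ → Fˣ := fun n => ∏ i ∈ Finset.range n, a i
    have hA (n) : A (n + 1) = A n * a n := Finset.prod_range_succ _ _
    choose q hq using fun n => (hv n).dvd (a := (κ (A n)).1 * h n)
    obtain ⟨S, hS⟩ := exists_ofEntire_eq hc (q := q) fun n => by
      refine mul_left_cancel₀ (hv n).ne_zero ?_
      have h1 : ((κ (A n)).1 : tateAlgebra (Fin m) F) =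
          (κ (A (n + 1))).1 * (κ (a n)⁻¹).1 := by
        rw [← Units.val_mul, ← map_mul, hA, mul_inv_cancel_right]
      rw [← hq n, ← hw n, h1, hvu n, mul_assoc, ← map_mul, ← hq (n + 1), map_mul, hκρ,
        Units.val_mul]
      ring
    refine ⟨S, fun n => ?_⟩
    rw [hS n]
    have h1 : Associated (q n) (v n * q n) := (associated_unit_mul_left _ _ (hv n)).symm
    rw [← hq n] at h1
    exact h1.trans (associated_unit_mul_left _ _ (κ (A n)).isUnit)

omit [CompleteSpace F] in
/-- Over a trivially normed field, entire functions and elements of the Tate algebra are both just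
polynomials. -/
lemma entireRing_eq_tateAlgebra (h : ∀ c : F, ‖c‖ ≤ 1) :
    entireRing F m = tateAlgebra (Fin m) F := by
  ext f
  refine ⟨fun hf => hf 1 fun _ => zero_le_one, fun hf r _ => ?_⟩
  refine tendsto_nhds_of_eventually_eq ?_
  filter_upwards [(mem_iff.1 hf).eventually (gt_mem_nhds one_pos)] with γ hγ
  suffices h0 : MvPowerSeries.coeff γ f = 0 by rw [h0, norm_zero, zero_mul]
  by_contra h0
  refine (h (MvPowerSeries.coeff γ f)⁻¹).not_gt ?_
  rw [norm_inv]
  exact (one_lt_inv₀ (norm_pos_iff.2 h0)).2 hγ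

end Entire

theorem mainTheorem4 (F : Type*) [NormedField F] [IsUltrametricDist F] [CompleteSpace F]
    [IsAlgClosed F] (m : ℕ) (f : entireRing F m) (hf : f ≠ 0) :
    ∃ S : entireRing F m, Squarefree S ∧
      ∀ P : entireRing F m, Irreducible P → (P ∣ S ↔ P ∣ f) := by
  by_cases h : ∃ c : F, 1 < ‖c‖
  · obtain ⟨c, hc⟩ := h
    exact (isApproximation_ofEntire hc).exists_squarefree_part hf
  · push Not at h
    let e := RingEquiv.subringCongr (entireRing_eq_tateAlgebra (m := m) h)
    have : UniqueFactorizationMonoid (entireRing F m) :=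
      e.symm.toMulEquiv.uniqueFactorizationMonoid inferInstance
    obtain ⟨S, n, hS, hSf, hfS⟩ := exists_squarefree_dvd_pow_of_ne_zero hf
    exact ⟨S, hS, fun P hP => ⟨fun h => h.trans hSf, fun h =>
      hP.prime.dvd_of_dvd_pow (h.trans hfS)⟩⟩
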